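/- **Models.** All graphs are on the vertex set $\{0,\dots,n-1\}$, undirected, with labels (e.g. weights) on vertices and edges. A graph problem $P$ on $n$-vertex graphs consists of an input domain and, for each input graph, a set of feasible output configurations, in which every vertex has an output. In both models below computation proceeds in synchronous rounds, local computation is free, every processor has a private random bit string (finite, of a length fixed by the algorithm), a message is a nonempty bit string, and a processor terminates (and is silent from then on) once it has irrevocably set its output. *Clique model.* The $n$ vertices are the nodes of a complete network; each node initially knows its own label, its incident edges in $G$ and their labels, and may send a message to each other node in each round. The message complexity of an algorithm is at most $M$ if at most $M$ messages are sent in total in every execution; its communication degree complexity is at most $\Delta'$ if every node sends at most $\Delta'$ and receives at most $\Delta'$ messages in every round. It is a broadcast algorithm if in every round every node sends the same message to all other nodes or is silent, and its broadcast complexity is at most $B$ if in every execution nodes broadcast at most $B$ times in total. It is an $\varepsilon$-error algorithm for $P$ if on each input its output is feasible with probability at least $1-\varepsilon$ over the random strings. *$k$-machine model with bandwidth $W$.* There are $k$ machines, every two of which are joined by a link over which at most $W$ bits are transmitted per round. Each vertex is assigned independently and uniformly at random to one of the machines, its home machine. Initially a machine knows the label and the incident edges (with labels) of each vertex assigned to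 it, and the home machine of every vertex (vertices are assigned by hashing their names). Finally it outputs the outputs of the vertices assigned to it. The algorithm is an $\varepsilon$-error algorithm for $P$ if on each input, with probability at least $1-\varepsilon$ over the random partition and the random strings, all machines terminate and the resulting output configuration is feasible. $\tilde O$ hides constant and polylogarithmic factors in $n$: $f\in\tilde O(g)$ if $f(n)\le c\,(\log n)^c\, g(n)$ for some $c$ and all large $n$. **Theorem (Conversion Theorem).** Let $T_C(n)\in\tilde O(n)$ and $b(n)\in\tilde O(1)$. There are constants $c,n_0$ (depending only on the functions $T_C$ and $b$) such that the following holds for all $n\ge n_0$, all $1<k\le n$, all $W\ge 1$, every graph problem $P$ on $n$-vertex graphs and every real $\varepsilon$. Suppose that $A_C$ is an $\varepsilon$-error algorithm for $P$ in the clique model which always terminates within $T_C(n)$ rounds and whose messages have at most $b(n)$ bits each. Then there is an $\varepsilon$-error algorithm $A$ for $P$ in the $k$-machine model with bandwidth $W$ such that, on every input graph, with probability at least $1-1/n$: (a) if $A_C$ has message complexity at most $M$ and communication degree complexity at most $\Delta'$, then $A$ terminates within $$c(\log n)^c\left(\frac{M}{k^2W}+T_C(n)\left\lceil\frac{\Delta'}{kW}\right\rceil\right)=\tilde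 O\left(\frac{M}{k^2W}+T_C(n)\left\lceil\frac{\Delta'}{kW}\right\rceil\right)\text{ rounds};$$ (b) if $A_C$ is a broadcast algorithm with broadcast complexity at most $B$, then $A$ terminates within $$c(\log n)^c\left(\frac{B}{kW}+T_C(n)\right)=\tilde O\left(\frac{B}{kW}+T_C(n)\right)\text{ rounds}.$$ -/

import Mathlib

noncomputable section

/-- `f ∈ Õ(g)`: up to a constant and a polylogarithmic factor in `n`, `f n` is at most `g n`
for all sufficiently large `n`. -/
def IsSoftO (f g : ℕ → ℝ) : Prop :=
  ∃ c n₀ : ℕ, ∀ n ≥ n₀, f n ≤ c * Real.log n ^ c * g n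

/-- Probability of the event `E` under the uniform distribution on the finite set `Ω`. -/
def uniformProb {Ω : Type} (E : Set Ω) : ℝ :=
  (Nat.card E : ℝ) / (Nat.card Ω : ℝ)

/-! ### Input graphs and graph problems -/

/-- An undirected graph on the vertices `0, …, n - 1` with labels (e.g. weights) on its vertices
and edges. -/
structure LabeledGraph (n : ℕ) (α β : Type) where
  graph : SimpleGraph (Fin n)
  vertexLabel : Fin n → α
  edgeLabel : graph.edgeSet → β

/-- What is known locally about one vertex `u`: its label and its incident edges.
`edge v = some b` means that `u` and `v` are joined by an edge with label `b`,
`edge v = none` that they are not adjacent. -/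
structure VertexView (n : ℕ) (α β : Type) where
  label : α
  edge : Fin n → Option β

open Classical in
/-- The local view of the vertex `u` in the input graph `G`. -/
def LabeledGraph.view {n : ℕ} {α β : Type} (G : LabeledGraph n α β) (u : Fin n) :
    VertexView n α β where
  label := G.vertexLabel u
  edge v := if h : G.graph.Adj u v then some (G.edgeLabel ⟨s(u, v), h⟩) else none

/-- A graph problem on `n`-vertex graphs: an input domain and the feasible output configurations,
where each vertex has an output in `O`. -/
structure GraphProblem (n : ℕ) (α β O : Type) where
  domain : Set (LabeledGraph n α β)
  feasible : LabeledGraph n α β → (Fin n → O) → Prop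

/-! ### Synchronous randomized algorithms on a complete network

Both models are complete networks of processors which proceed in synchronous rounds.
A message is a nonempty bit string; the empty string stands for "no message". -/

/-- A synchronous randomized message passing algorithm on a complete network whose processors
form the set `N`. A processor starts with some knowledge in `K` and a private string of `coins`
random bits. In each round it sends to each other processor a message depending on its state,
and then updates its state according to the messages received. It terminates as soon as its
irrevocable output is set. Local computation is unrestricted. -/
structure SyncAlgorithm (N K Out : Type) where
  State : Type
  coins : ℕ
  init : N → K → (Fin coins → Bool) → State
  send : N → State → N → List Bool
  receive : N → State → (N → List Bool) → State
  output : N → State → Option Out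

namespace SyncAlgorithm

variable {N K Out : Type} [DecidableEq N] (A : SyncAlgorithm N K Out)

/-- The message that `u` sends to `v` in the round that starts in the configuration `σ`:
processors do not send to themselves, and terminated processors are silent. -/
def transmit (σ : N → A.State) (u v : N) : List Bool :=
  if u = v ∨ (A.output u (σ u)).isSome then [] else A.send u (σ u) v

/-- The configuration after one round; terminated processors no longer change. -/
def step (σ : N → A.State) : N → A.State := fun u =>
  if (A.output u (σ u)).isSome then σ u else A.receive u (σ u) (fun v => A.transmit σ v u)

/-- The configuration after `t` rounds, for given initial knowledge and random strings. -/
def config (know : N → K) (tape : N → Fin A.coins → Bool) (t : ℕ) : N → A.State :=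
  A.step^[t] (fun u => A.init u (know u) (tape u))

/-- The message that `u` sends to `v` in round `t` (rounds are numbered from `0`). -/
def message (know : N → K) (tape : N → Fin A.coins → Bool) (t : ℕ) (u v : N) : List Bool :=
  A.transmit (A.config know tape t) u v

/-- The output of `u` after `t` rounds, if it has been set. -/
def outputAt (know : N → K) (tape : N → Fin A.coins → Bool) (t : ℕ) (u : N) : Option Out :=
  A.output u (A.config know tape t u)

/-- All processors have terminated after at most `t` rounds. -/
def HaltsBy (know : N → K) (tape : N → Fin A.coins → Bool) (t : ℕ) : Prop :=
  ∀ u, (A.outputAt know tape t u).isSome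

end SyncAlgorithm

/-! ### The clique model -/

/-- An algorithm in the `n`-node clique model: node `u` initially knows its local view of the
input graph, and finally outputs an element of `O`. -/
abbrev CliqueAlgorithm (n : ℕ) (α β O : Type) :=
  SyncAlgorithm (Fin n) (VertexView n α β) O

namespace CliqueAlgorithm

variable {n : ℕ} {α β O : Type} (A : CliqueAlgorithm n α β O) (P : GraphProblem n α β O)

/-- `A` is an `ε`-error algorithm for `P`: on each input graph its output is feasible with
probability at least `1 - ε` over the private random strings of the nodes. -/
def HasError (ε : ℝ) : Prop :=
  ∀ G ∈ P.domain, 1 - ε ≤ uniformProb {tape : Fin n → Fin A.coins → Bool |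
    ∃ (t : ℕ) (o : Fin n → O), P.feasible G o ∧ ∀ v, A.outputAt G.view tape t v = some (o v)}

/-- `A` always terminates within `T` rounds. -/
def TimeAtMost (T : ℕ) : Prop :=
  ∀ G ∈ P.domain, ∀ tape, A.HaltsBy G.view tape T

/-- Every message sent by `A` has at most `b` bits. -/
def MessageSizeAtMost (b : ℕ) : Prop :=
  ∀ G ∈ P.domain, ∀ tape t u v, (A.message G.view tape t u v).length ≤ b

/-- The message complexity is at most `M`: in each execution at most `M` messages are sent in
total, over all links and all rounds. -/
def MessageComplexityAtMost (M : ℕ) : Prop :=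
  ∀ G ∈ P.domain, ∀ tape, ∀ τ : ℕ,
    ∑ t ∈ Finset.range τ, (Finset.univ.filter
      (fun p : Fin n × Fin n => A.message G.view tape t p.1 p.2 ≠ [])).card ≤ M

/-- The communication degree complexity is at most `D`: each node sends at most `D` messages and
receives at most `D` messages in each round. -/
def CommDegreeAtMost (D : ℕ) : Prop :=
  ∀ G ∈ P.domain, ∀ tape t u,
    (Finset.univ.filter (fun v => A.message G.view tape t u v ≠ [])).card ≤ D ∧
    (Finset.univ.filter (fun v => A.message G.view tape t v u ≠ [])).card ≤ D

/-- `A` is a broadcast algorithm: in each round each node sends the same message to all other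
nodes, or remains silent. -/
def IsBroadcast : Prop :=
  ∀ G ∈ P.domain, ∀ tape t u v w, v ≠ u → w ≠ u →
    A.message G.view tape t u v = A.message G.view tape t u w

/-- The broadcast complexity is at most `B`: in each execution the nodes broadcast at most `B`
times in total. -/
def BroadcastComplexityAtMost (B : ℕ) : Prop :=
  ∀ G ∈ P.domain, ∀ tape, ∀ τ : ℕ,
    ∑ t ∈ Finset.range τ, (Finset.univ.filter
      (fun u : Fin n => ∃ v, A.message G.view tape t u v ≠ [])).card ≤ B

end CliqueAlgorithm

/-! ### The `k`-machine model -/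

/-- The initial knowledge of a machine: the home machine of every vertex (vertices are assigned by
hashing their names), and the local view of those vertices that are hosted at the machine. -/
structure MachineView (n k : ℕ) (α β : Type) where
  home : Fin n → Fin k
  hosted : Fin n → Option (VertexView n α β)

/-- The initial knowledge of machine `i` if the vertex `v` of `G` is assigned to machine `h v`. -/
def LabeledGraph.machineView {n k : ℕ} {α β : Type} (G : LabeledGraph n α β)
    (h : Fin n → Fin k) (i : Fin k) : MachineView n k α β where
  home := h
  hosted v := if h v = i then some (G.view v) else none

/-- An algorithm in the `k`-machine model. The output of a machine is a partial assignment of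
outputs to vertices; it has to cover the vertices hosted at the machine. -/
abbrev KMachineAlgorithm (n k : ℕ) (α β O : Type) :=
  SyncAlgorithm (Fin k) (MachineView n k α β) (Fin n → Option O)

namespace KMachineAlgorithm

variable {n k : ℕ} {α β O : Type} (A : KMachineAlgorithm n k α β O) (P : GraphProblem n α β O)

/-- The sample space: the partition assigns each vertex independently and uniformly to a machine,
and each machine has a private random string. All these choices are independent and uniform, so
that the probability measure is the uniform one. -/
abbrev Sample : Type :=
  (Fin n → Fin k) × (Fin k → Fin A.coins → Bool)

/-- In each round at most `W` bits are transmitted over each link, both directions together. -/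
def RespectsBandwidth (W : ℕ) : Prop :=
  ∀ G ∈ P.domain, ∀ (h : Fin n → Fin k) tape t i j,
    (A.message (G.machineView h) tape t i j).length +
      (A.message (G.machineView h) tape t j i).length ≤ W

/-- `A` is an `ε`-error algorithm for `P`: on each input graph, with probability at least `1 - ε`
over the random partition and the random strings, all machines terminate and the outputs which
the vertices get from their home machines form a feasible output configuration. -/
def HasError (ε : ℝ) : Prop :=
  ∀ G ∈ P.domain, 1 - ε ≤ uniformProb {ω : Sample A |
    ∃ (t : ℕ) (o : Fin n → O), P.feasible G o ∧ A.HaltsBy (G.machineView ω.1) ω.2 t ∧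
      ∀ v, ∃ p : Fin n → Option O,
        A.outputAt (G.machineView ω.1) ω.2 t (ω.1 v) = some p ∧ p v = some (o v)}

/-- With high probability, i.e. with probability at least `1 - 1 / n` on each input graph, `A`
terminates in at most `τ` rounds. -/
def TimeAtMostWhp (τ : ℝ) : Prop :=
  ∀ G ∈ P.domain, 1 - 1 / (n : ℝ) ≤ uniformProb {ω : Sample A |
    ∃ t : ℕ, (t : ℝ) ≤ τ ∧ A.HaltsBy (G.machineView ω.1) ω.2 t}

end KMachineAlgorithm

end

noncomputable section

/-! ### Restricting the bandwidth of a synchronous algorithm -/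

/-! Every machine runs the clique nodes of the vertices it hosts. To simulate a round, machine `i`
sends machine `j` the set of messages from its vertices to those of `j`, as packets of `O(log n +
b)` bits. If a round has `m` messages and degrees at most `D`, a given link carries `O(m / k ^ 2 + D
log n / k + log ^ 2 n)` packets with high probability (`uniformProb_linkLoad_ge`); summing over
rounds gives (a). A broadcasting vertex needs only one packet per machine, so with `m` broadcasts
the load is at most the number of broadcasting vertices of one class, `O(m / k + log n)`
(`uniformProb_classSize_ge`); this gives (b).

These bounds concern a fixed clique execution and a random partition. They apply because the random
strings of the vertices are independent of the partition (`uniformProb_vertexTape`); a union bound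
covers all rounds and links (`linkLoad_le_whp`).

The time spent on a clique round is not fixed in advance: machines tell each other whether they
still have bits to send (`throttle_output`). Hence the simulation is faithful for every partition
and adds no error (`simulate_hasError`); only its running time is random (`simulate_time`).

The bound in (a) vanishes when `M = Δ' = 0`, so an algorithm that never sends anything has to be
simulated in zero rounds; `skipRounds` serves this case. -/

/-- The state of a processor that simulates, in chunks of bounded size, a synchronous algorithm
with states in `S` and unbounded messages. -/
structure ThrottleState (S N : Type) where
  inner : S
  phase : ℕ
  sent : ℕ
  slot : ℕ
  inbox : N → List Bool
  more : Prop

namespace SyncAlgorithm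

variable {N K Out : Type}

theorem isSome_output_empty (B : SyncAlgorithm N K Empty) (u : N) (s : B.State) :
    (B.output u s).isSome = false := by
  cases h : B.output u s with
  | none => rfl
  | some x => exact x.elim

theorem config_succ [DecidableEq N] (A : SyncAlgorithm N K Out) (know : N → K) (tape : N → Fin A.coins → Bool)
    (t : ℕ) : A.config know tape (t + 1) = A.step (A.config know tape t) :=
  Function.iterate_succ_apply' ..

theorem transmit_self [DecidableEq N] (A : SyncAlgorithm N K Out) (σ : N → A.State) (u : N) :
    A.transmit σ u u = [] := by
  simp [transmit]

variable [LinearOrder N]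

/-- Some message that `u` sends in the current phase does not fit into `d + 1` chunks. -/
def HasMore (B : SyncAlgorithm N K Empty) (W : ℕ) (u : N) (s : B.State) (d : ℕ) : Prop :=
  ∃ v, v ≠ u ∧ (d + 1) * W < (B.send u s v).length

open Classical in
/-- Simulation of `T` rounds of `B` with bandwidth `W`. A round of `B` is a phase, in which
messages are sent in chunks of `W` bits. For each chunk there are four slots: the chunk is sent to
larger processors, then to smaller ones, and then every processor tells first all larger and then
all smaller ones whether it needs another chunk in this phase. -/

@[reducible] def throttle (B : SyncAlgorithm N K Empty) (out : N → B.State → Out) (T W : ℕ) :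
    SyncAlgorithm N K Out where
  State := ThrottleState B.State N
  coins := B.coins
  init u κ tape := ⟨B.init u κ tape, 0, 0, 0, fun _ => [], False⟩
  send u s v :=
    if s.slot = 0 then
      if u < v then ((B.send u s.inner v).drop (s.sent * W)).take W else []
    else if s.slot = 1 then
      if v < u then ((B.send u s.inner v).drop (s.sent * W)).take W else []
    else if s.slot = 2 then
      if u < v ∧ B.HasMore W u s.inner s.sent then [true] else []
    else
      if v < u ∧ B.HasMore W u s.inner s.sent then [true] else []
  receive u s f :=
    if s.slot = 0 then { s with slot := 1, inbox := fun v => s.inbox v ++ f v }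
    else if s.slot = 1 then { s with slot := 2, inbox := fun v => s.inbox v ++ f v }
    else if s.slot = 2 then
      { s with slot := 3, more := B.HasMore W u s.inner s.sent ∨ ∃ v, f v ≠ [] }
    else if s.more ∨ ∃ v, f v ≠ [] then
      { s with slot := 0, sent := s.sent + 1, more := False }
    else
      ⟨B.receive u s.inner s.inbox, s.phase + 1, 0, 0, fun _ => [], False⟩
  output u s := if s.phase = T then some (out u s.inner) else none

variable (B : SyncAlgorithm N K Empty) (out : N → B.State → Out) {T : ℕ} (W : ℕ)

/-- The state of processor `u` in slot `q` for chunk `d` of phase `r`, where `σ` is the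
configuration of the simulated algorithm. -/
def throttleState (σ : N → B.State) (r d q : ℕ) (u : N) : ThrottleState B.State N where
  inner := σ u
  phase := r
  sent := d
  slot := q
  inbox v := (B.transmit σ v u).take
    -- After slot 0 chunk `d` has arrived from the smaller processors only, after slot 1 from all.
    (if (q = 1 ∧ v < u) ∨ 2 ≤ q then (d + 1) * W else d * W)
  more := q = 3 ∧ (B.HasMore W u (σ u) d ∨ ∃ v < u, B.HasMore W v (σ v) d)

theorem transmit_empty (σ : N → B.State) (u v : N) :
    B.transmit σ u v = if u = v then [] else B.send u (σ u) v := by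
  simp [transmit, isSome_output_empty]

theorem step_empty (σ : N → B.State) (u : N) :
    B.step σ u = B.receive u (σ u) (fun v => B.transmit σ v u) := by
  simp [step, isSome_output_empty]

variable {σ : N → B.State} {r d : ℕ}

theorem throttle_transmit {q : ℕ} (hr : r ≠ T) (u v : N) :
    (B.throttle out T W).transmit (B.throttleState W σ r d q) u v =
      if u = v then [] else (B.throttle out T W).send u (B.throttleState W σ r d q u) v := by
  simp [transmit, throttleState, hr]

theorem throttle_step {q : ℕ} (hr : r ≠ T) (u : N) :
    (B.throttle out T W).step (B.throttleState W σ r d q) u =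
      (B.throttle out T W).receive u (B.throttleState W σ r d q u)
        (fun v => (B.throttle out T W).transmit (B.throttleState W σ r d q) v u) := by
  simp [step, throttle, throttleState, hr]

theorem throttle_receive_slot_zero {u : N} {s : ThrottleState B.State N} {f : N → List Bool}
    (hs : s.slot = 0) : (B.throttle out T W).receive u s f =
      { s with slot := 1, inbox := fun v => s.inbox v ++ f v } := by
  simp [hs]

theorem throttle_receive_slot_one {u : N} {s : ThrottleState B.State N} {f : N → List Bool}
    (hs : s.slot = 1) : (B.throttle out T W).receive u s f =
      { s with slot := 2, inbox := fun v => s.inbox v ++ f v } := by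
  simp [hs]

theorem throttle_receive_slot_two {u : N} {s : ThrottleState B.State N} {f : N → List Bool}
    (hs : s.slot = 2) : (B.throttle out T W).receive u s f =
      { s with slot := 3, more := B.HasMore W u s.inner s.sent ∨ ∃ v, f v ≠ [] } := by
  simp [hs]

theorem throttle_send_length (hW : 1 ≤ W) (u : N) (s : ThrottleState B.State N) (v : N) :
    ((B.throttle out T W).send u s v).length ≤
      if (u < v ∧ (s.slot = 0 ∨ s.slot = 2)) ∨ (v < u ∧ ¬ (s.slot = 0 ∨ s.slot = 2))
      then W else 0 := by
  by_cases h0 : s.slot = 0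
  · by_cases h : u < v <;> simp [h0, h]
  by_cases h1 : s.slot = 1
  · by_cases h : v < u <;> simp [h1, h]
  by_cases h2 : s.slot = 2
  · by_cases h : u < v
    · simp only [h2, h]; split_ifs <;> simp_all
    · simp [h2, h]
  · by_cases h : v < u
    · simp only [h0, h1, h2, h]; split_ifs <;> simp_all
    · simp [h0, h1, h2, h]

theorem throttle_step_slot_zero (hr : r ≠ T) :
    (B.throttle out T W).step (B.throttleState W σ r d 0) = B.throttleState W σ r d 1 := by
  funext u
  rw [throttle_step _ _ _ hr]
  rw [throttle_receive_slot_zero B out W rfl]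
  simp only [throttle_transmit _ _ _ hr]
  simp only [throttleState, ThrottleState.mk.injEq, true_and]
  refine ⟨?_, by simp⟩
  funext v
  rcases lt_trichotomy v u with h | h | h
  · simp [h, h.ne, transmit_empty, add_mul, List.take_add]
  · simp [h, transmit_empty]
  · simp [h.ne', h.not_gt, transmit_empty]

theorem throttle_step_slot_one (hr : r ≠ T) :
    (B.throttle out T W).step (B.throttleState W σ r d 1) = B.throttleState W σ r d 2 := by
  funext u
  rw [throttle_step _ _ _ hr]
  rw [throttle_receive_slot_one B out W rfl]
  simp only [throttle_transmit _ _ _ hr]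
  simp only [throttleState, ThrottleState.mk.injEq, true_and]
  refine ⟨?_, by simp⟩
  funext v
  rcases lt_trichotomy v u with h | h | h
  · simp [h, h.ne, h.not_gt, transmit_empty]
  · simp [h, transmit_empty]
  · simp [h, h.ne', h.not_gt, transmit_empty, add_mul, List.take_add]

theorem throttle_step_slot_two (hr : r ≠ T) :
    (B.throttle out T W).step (B.throttleState W σ r d 2) = B.throttleState W σ r d 3 := by
  funext u
  rw [throttle_step _ _ _ hr]
  rw [throttle_receive_slot_two B out W rfl]
  simp only [throttle_transmit _ _ _ hr]
  simp only [throttleState, ThrottleState.mk.injEq, true_and]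
  refine ⟨by simp, ?_⟩
  simp only [eq_iff_iff]
  refine or_congr_right (exists_congr fun v => ?_)
  by_cases h : v = u
  · simp [h]
  · by_cases h' : v < u ∧ B.HasMore W v (σ v) d <;> simp [h, h']

theorem hasMore_iff {u : N} :
    B.HasMore W u (σ u) d ↔ ∃ v, (d + 1) * W < (B.transmit σ u v).length := by
  refine exists_congr fun v => ?_
  by_cases h : v = u
  · simp [h, transmit_empty]
  · simp [h, transmit_empty, Ne.symm h]

-- After slots 2 and 3 each processor has heard from all others, so all take the same decision and
-- stay in lockstep. If nobody needs another chunk, the inboxes hold the complete messages.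
open Classical in
theorem throttle_step_slot_three (hr : r ≠ T) :
    (B.throttle out T W).step (B.throttleState W σ r d 3) =
      if ∃ u, B.HasMore W u (σ u) d then B.throttleState W σ r (d + 1) 0
      else B.throttleState W (B.step σ) (r + 1) 0 0 := by
  funext u
  have key : ((B.HasMore W u (σ u) d ∨ ∃ v < u, B.HasMore W v (σ v) d) ∨
      ∃ v, (B.throttle out T W).transmit (B.throttleState W σ r d 3) v u ≠ []) ↔
      ∃ u, B.HasMore W u (σ u) d := by
    simp only [throttle_transmit _ _ _ hr]
    constructor
    · rintro ((h | ⟨v, -, h⟩) | ⟨v, h⟩)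
      · exact ⟨u, h⟩
      · exact ⟨v, h⟩
      · by_cases hm : B.HasMore W v (σ v) d
        · exact ⟨v, hm⟩
        · simp [throttleState, hm] at h
    · rintro ⟨v, h⟩
      rcases lt_trichotomy v u with hv | hv | hv
      · exact Or.inl (Or.inr ⟨v, hv, h⟩)
      · exact Or.inl (Or.inl (hv ▸ h))
      · exact Or.inr ⟨v, by simp [hv.ne', throttleState, h, hv]⟩
  rw [throttle_step _ _ _ hr]
  have hrec : ∀ (s : ThrottleState B.State N) (f : N → List Bool), s.slot = 3 →
      (B.throttle out T W).receive u s f = if s.more ∨ ∃ v, f v ≠ [] then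
      { s with slot := 0, sent := s.sent + 1, more := False }
      else ⟨B.receive u s.inner s.inbox, s.phase + 1, 0, 0, fun _ => [], False⟩ := by
    intro s f hs
    simp [throttle, hs]
  rw [hrec _ _ rfl]
  have hmore : (B.throttleState W σ r d 3 u).more ↔
    (B.HasMore W u (σ u) d ∨ ∃ v < u, B.HasMore W v (σ v) d) := by simp [throttleState]
  rw [hmore]
  by_cases h : ∃ u, B.HasMore W u (σ u) d
  · rw [if_pos (key.2 h), if_pos h]
    simp [throttleState]
  · rw [if_neg (fun h' => h (key.1 h')), if_neg h]
    have hin : (B.throttleState W σ r d 3 u).inbox = fun v => B.transmit σ v u := by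
      funext v
      simp only [throttleState]
      refine List.take_of_length_le ?_
      simp only [hasMore_iff, not_exists, not_lt] at h
      simpa using h v u
    rw [hin]
    simp only [throttleState, step_empty, zero_mul, ThrottleState.mk.injEq, true_and]
    simp

open Classical in
theorem throttle_four_steps (hr : r ≠ T) :
    (B.throttle out T W).step^[4] (B.throttleState W σ r d 0) =
      if ∃ u, B.HasMore W u (σ u) d then B.throttleState W σ r (d + 1) 0
      else B.throttleState W (B.step σ) (r + 1) 0 0 := by
  simp only [Function.iterate_succ, Function.iterate_zero, Function.comp_apply, id_eq,
    throttle_step_slot_zero B out W hr, throttle_step_slot_one B out W hr,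
    throttle_step_slot_two B out W hr, throttle_step_slot_three B out W hr]

/-- Here `c` bounds the number of chunks still needed after chunk `d`; each chunk costs four slots,
and the phase may end early. -/
theorem throttle_phase (hr : r ≠ T) (c : ℕ) :
    ∀ d, (∀ u v, (B.transmit σ u v).length ≤ (d + 1 + c) * W) →
      ∃ t ≤ 4 * (c + 1), (B.throttle out T W).step^[t] (B.throttleState W σ r d 0) =
        B.throttleState W (B.step σ) (r + 1) 0 0 := by
  classical
  induction c with
  | zero =>
    intro d h
    refine ⟨4, le_rfl, ?_⟩
    rw [throttle_four_steps B out W hr, if_neg]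
    rintro ⟨u, hu⟩
    obtain ⟨v, hv⟩ := (hasMore_iff B W).1 hu
    exact absurd (h u v) (by simpa using hv)
  | succ c ih =>
    intro d h
    by_cases hm : ∃ u, B.HasMore W u (σ u) d
    · obtain ⟨t, ht, h'⟩ := ih (d + 1) (fun u v => (h u v).trans_eq (by ring))
      refine ⟨t + 4, by omega, ?_⟩
      rw [Function.iterate_add_apply, throttle_four_steps B out W hr, if_pos hm, h']
    · refine ⟨4, by omega, ?_⟩
      rw [throttle_four_steps B out W hr, if_neg hm]

theorem throttle_step_terminated {q : ℕ} :
    (B.throttle out T W).step (B.throttleState W σ T d q) = B.throttleState W σ T d q := by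
  funext u
  simp [step, throttle, throttleState]

variable (know : N → K) (tape : N → Fin B.coins → Bool)

theorem throttle_config_zero :
    (B.throttle out T W).config know tape 0 =
      B.throttleState W (B.config know tape 0) 0 0 0 := by
  funext u
  simp [throttle, throttleState, config]

/-- The lockstep invariant. It needs no bound on message lengths, so the bandwidth bound derived
from it holds in every execution. -/
theorem throttle_config (t : ℕ) :
    ∃ σ r d q, (B.throttle out T W).config know tape t = B.throttleState W σ r d q := by
  classical
  suffices h : ∃ σ r d q, q < 4 ∧
      (B.throttle out T W).config know tape t = B.throttleState W σ r d q by
    obtain ⟨σ, r, d, q, -, h⟩ := h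
    exact ⟨σ, r, d, q, h⟩
  induction t with
  | zero => exact ⟨_, _, _, 0, by norm_num, throttle_config_zero B out W know tape⟩
  | succ t ih =>
    obtain ⟨σ, r, d, q, hq, h⟩ := ih
    rw [config_succ, h]
    by_cases hr : r = T
    · exact ⟨_, _, _, _, hq, by rw [hr, throttle_step_terminated]⟩
    interval_cases q
    · exact ⟨_, _, _, 1, by norm_num, throttle_step_slot_zero B out W hr⟩
    · exact ⟨_, _, _, 2, by norm_num, throttle_step_slot_one B out W hr⟩
    · exact ⟨_, _, _, 3, by norm_num, throttle_step_slot_two B out W hr⟩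
    · by_cases hm : ∃ u, B.HasMore W u (σ u) d
      · exact ⟨_, _, _, 0, by norm_num,
          (throttle_step_slot_three B out W hr).trans (if_pos hm)⟩
      · exact ⟨_, _, _, 0, by norm_num,
          (throttle_step_slot_three B out W hr).trans (if_neg hm)⟩

/-- In each round at most `W` bits are sent over each link of `B.throttle out T W`. -/
theorem throttle_bandwidth (hW : 1 ≤ W) (t : ℕ) (u v : N) :
    ((B.throttle out T W).message know tape t u v).length +
      ((B.throttle out T W).message know tape t v u).length ≤ W := by
  classical
  obtain ⟨σ, r, d, q, h⟩ := throttle_config B out (T := T) W know tape t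
  -- In a given slot all traffic goes upwards or all goes downwards, so a link is used in one
  -- direction only.
  have hlen : ∀ a b : N, ((B.throttle out T W).message know tape t a b).length ≤
      if (a < b ∧ (q = 0 ∨ q = 2)) ∨ (b < a ∧ ¬ (q = 0 ∨ q = 2)) then W else 0 := by
    intro a b
    refine le_trans ?_ (throttle_send_length B out (T := T) W hW a (B.throttleState W σ r d q a) b)
    rw [message, h, transmit]
    split <;> simp
  refine (add_le_add (hlen u v) (hlen v u)).trans ?_
  split_ifs with h1 h2 h2
  · rcases h1 with h1 | h1 <;> rcases h2 with h2 | h2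
    · exact absurd h1.1 h2.1.not_gt
    · exact absurd h1.2 h2.2
    · exact absurd h2.2 h1.2
    · exact absurd h1.1 h2.1.not_gt
  all_goals simp

/-- The simulation of round `r` of `B` takes `O(L / W + 1)` rounds, where `L` is the maximum length
of a message in that round. -/
theorem throttle_output (hW : 1 ≤ W) (L : ℕ → ℕ)
    (hL : ∀ r < T, ∀ u v, (B.message know tape r u v).length ≤ L r) :
    ∃ t ≤ ∑ r ∈ Finset.range T, 4 * (L r / W + 1), ∀ u,
      (B.throttle out T W).outputAt know tape t u = some (out u (B.config know tape T u)) := by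
  have key : ∀ r ≤ T, ∃ t ≤ ∑ r ∈ Finset.range r, 4 * (L r / W + 1),
      (B.throttle out T W).config know tape t =
        B.throttleState W (B.config know tape r) r 0 0 := by
    intro r
    induction r with
    | zero => exact fun _ => ⟨0, by simp, throttle_config_zero B out W know tape⟩
    | succ r ih =>
      intro hr
      obtain ⟨t, ht, h⟩ := ih (by omega)
      obtain ⟨t', ht', h'⟩ := throttle_phase B out W (T := T) (r := r)
        (σ := B.config know tape r) (by omega) (L r / W) 0 (fun u v => by
          refine (hL r (by omega) u v).trans ?_
          have := Nat.lt_div_mul_add (a := L r) (b := W) (by omega)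
          rw [zero_add, add_mul]
          omega)
      refine ⟨t' + t, ?_, ?_⟩
      · rw [Finset.sum_range_succ]; omega
      · rw [config_succ, ← h', ← h]
        exact Function.iterate_add_apply _ _ _ _
  obtain ⟨t, ht, h⟩ := key T le_rfl
  refine ⟨t, ht, fun u => ?_⟩
  rw [outputAt, h]
  simp [throttleState]

end SyncAlgorithm

/-! ### Encoding sets of packets -/

/-- Finite sets over a type with at most `2 ^ s` elements can be encoded by `s` bits per element. -/
theorem exists_finset_code (ι : Type) [Fintype ι] {s : ℕ} (hs : 0 < s)
    (h : Fintype.card ι ≤ 2 ^ s) :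
    ∃ enc : Finset ι → List Bool, Function.Injective enc ∧ ∀ S, (enc S).length = s * S.card := by
  classical
  obtain ⟨e⟩ : Nonempty (ι ↪ (Fin s → Bool)) :=
    Function.Embedding.nonempty_of_card_le (by simpa using h)
  -- All codewords have the same length `s`, so a concatenation splits uniquely; `0 < s` excludes
  -- confusion with the empty list.
  have hinj : Function.Injective fun l : List ι => l.flatMap fun x => List.ofFn (e x) := by
    intro l
    induction l with
    | nil =>
      rintro (_ | ⟨y, l'⟩) h
      · rfl
      · have := congrArg List.length h
        simp at this
        omega
    | cons x l ih =>
      rintro (_ | ⟨y, l'⟩) h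
      · have := congrArg List.length h
        simp at this
        omega
      · simp only [List.flatMap_cons] at h
        obtain ⟨h1, h2⟩ := List.append_inj h (by simp)
        rw [e.injective (List.ofFn_injective h1), ih h2]
  refine ⟨fun S => S.toList.flatMap fun x => List.ofFn (e x), fun S S' h => ?_, fun S => ?_⟩
  · rw [← Finset.toList_toFinset S, ← Finset.toList_toFinset S', hinj h]
  · simp [List.length_flatMap, mul_comm]

/-- A packet: the sender, the addressee, and the bits of a message of length at most `b`. -/
abbrev Packet (n b : ℕ) : Type := Fin n × Fin n × (Fin b → Option Bool)

/-- The packet with message `m` from `u` to `w`. -/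
def packet {n : ℕ} (b : ℕ) (u w : Fin n) (m : List Bool) : Packet n b :=
  (u, w, fun x => m[(x : ℕ)]?)

theorem packet_inj {n b : ℕ} {u u' w w' : Fin n} {m m' : List Bool} (hm : m.length ≤ b)
    (hm' : m'.length ≤ b) : packet b u w m = packet b u' w' m' ↔ u = u' ∧ w = w' ∧ m = m' := by
  constructor
  · intro h
    simp only [packet, Prod.mk.injEq] at h
    refine ⟨h.1, h.2.1, List.ext_getElem? fun i => ?_⟩
    by_cases hi : i < b
    · exact congrFun h.2.2 ⟨i, hi⟩
    · rw [List.getElem?_eq_none (by omega), List.getElem?_eq_none (by omega)]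
  · rintro ⟨rfl, rfl, rfl⟩
    rfl

/-- Each vertex name takes `Nat.clog 2 n` bits, and each of the `b` positions has `3 ≤ 2 ^ 2`
values. The empty set gets the empty code, so a link without packets stays silent. -/
theorem exists_packet_code (n b : ℕ) (hn : 2 ≤ n) :
    ∃ enc : Finset (Packet n b) → List Bool, Function.Injective enc ∧
      ∀ S, (enc S).length = (2 * Nat.clog 2 n + 2 * b) * S.card := by
  have hc := Nat.clog_pos one_lt_two hn
  refine exists_finset_code _ (by omega) ?_
  have h1 : n ≤ 2 ^ Nat.clog 2 n := Nat.le_pow_clog one_lt_two n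
  simp only [Fintype.card_prod, Fintype.card_fin, Fintype.card_fun, Fintype.card_option,
    Fintype.card_bool]
  calc n * (n * 3 ^ b) ≤ 2 ^ Nat.clog 2 n * (2 ^ Nat.clog 2 n * (2 ^ 2) ^ b) := by
        gcongr; norm_num
    _ = 2 ^ (2 * Nat.clog 2 n + 2 * b) := by rw [← pow_mul]; ring

open Classical in
/-- The message from `u` to `w` in a set of packets, if there is one. -/
def lookup {n b : ℕ} (S : Finset (Packet n b)) (u w : Fin n) : List Bool :=
  if h : ∃ m : List Bool, m.length ≤ b ∧ packet b u w m ∈ S then h.choose else []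

/-! ### Simulating the clique with machines of unbounded bandwidth -/

namespace CliqueAlgorithm

variable {n k : ℕ} {α β O : Type} (A : CliqueAlgorithm n α β O)

/-- The message from `u` to `w`, if `x` is what is known about the state of `u`. -/
def localTransmit (x : Option A.State) (u w : Fin n) : List Bool :=
  x.elim [] fun s => if u = w ∨ (A.output u s).isSome then [] else A.send u s w

/-- The packets which machine `i` has to send to machine `j`. The packet that serves a pair `(u, v)`
of vertices is addressed to `ρ u v`. -/
def packets (b : ℕ) (ρ : Fin n → Fin n → Fin n) (h : Fin n → Fin k)
    (x : Fin n → Option A.State) (i j : Fin k) : Finset (Packet n b) :=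
  (Finset.univ.filter fun p : Fin n × Fin n =>
    h p.1 = i ∧ h p.2 = j ∧ A.localTransmit (x p.1) p.1 (ρ p.1 p.2) ≠ []).image
    fun p => packet b p.1 (ρ p.1 p.2) (A.localTransmit (x p.1) p.1 (ρ p.1 p.2))

/-- The random strings of the vertices, taken from those of their home machines. -/
def vertexTape {c : ℕ} (h : Fin n → Fin k) (tape : Fin k → Fin (n * c) → Bool) :
    Fin n → Fin c → Bool :=
  fun v x => tape (h v) (finProdFinEquiv (v, x))

/-- Each machine simulates the vertices it hosts; `enc` encodes sets of packets. -/
@[reducible] def relay (k b : ℕ) (ρ : Fin n → Fin n → Fin n)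
    (enc : Finset (Packet n b) → List Bool) :
    SyncAlgorithm (Fin k) (MachineView n k α β) Empty where
  State := (Fin n → Fin k) × (Fin n → Option A.State)
  coins := n * A.coins
  init _ κ tape := (κ.home, fun v => (κ.hosted v).map fun x =>
    A.init v x fun c => tape (finProdFinEquiv (v, c)))
  send i st j := enc (A.packets b ρ st.1 st.2 i j)
  receive i st f := (st.1, fun v => (st.2 v).map fun s =>
    if (A.output v s).isSome then s else A.receive v s fun u =>
      if u = v then [] else if st.1 u = i then A.localTransmit (st.2 u) u v
      else lookup (Function.invFun enc (f (st.1 u))) u (ρ u v))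
  output _ _ := none

/-- What machine `i` knows about the configuration `σ`. -/
def hostedStates (h : Fin n → Fin k) (σ : Fin n → A.State) (i : Fin k) (v : Fin n) :
    Option A.State :=
  if h v = i then some (σ v) else none

variable {A} {b : ℕ} {ρ : Fin n → Fin n → Fin n} {h : Fin n → Fin k} {σ : Fin n → A.State}

theorem localTransmit_hostedStates {i : Fin k} {u : Fin n} (hu : h u = i) (w : Fin n) :
    A.localTransmit (A.hostedStates h σ i u) u w = A.transmit σ u w := by
  simp [localTransmit, hostedStates, hu, SyncAlgorithm.transmit]

/-- All packets from `u` addressed to `ρ u v` carry the same message, so the choice made by `lookup`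
is irrelevant; a missing packet means that there was no message. -/
theorem lookup_packets (hlen : ∀ u v, (A.transmit σ u v).length ≤ b) {u v : Fin n} :
    lookup (A.packets b ρ h (A.hostedStates h σ (h u)) (h u) (h v)) u (ρ u v) =
      A.transmit σ u (ρ u v) := by
  have key : ∀ m : List Bool, m.length ≤ b → packet b u (ρ u v) m ∈
      A.packets b ρ h (A.hostedStates h σ (h u)) (h u) (h v) →
      m = A.transmit σ u (ρ u v) := by
    intro m hm hmem
    simp only [packets, Finset.mem_image, Finset.mem_filter, Finset.mem_univ, true_and] at hmem
    obtain ⟨p, ⟨hp1, -, -⟩, hp⟩ := hmem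
    rw [localTransmit_hostedStates hp1, packet_inj (hlen _ _) hm] at hp
    rw [← hp.2.2, hp.2.1, hp.1]
  unfold lookup
  split_ifs with hex
  · exact key _ hex.choose_spec.1 hex.choose_spec.2
  · by_contra hne
    refine hex ⟨A.transmit σ u (ρ u v), hlen _ _, ?_⟩
    simp only [packets, Finset.mem_image, Finset.mem_filter, Finset.mem_univ, true_and]
    refine ⟨(u, v), ⟨rfl, rfl, ?_⟩, ?_⟩
    · rw [localTransmit_hostedStates rfl]; exact fun h => hne h.symm
    · rw [localTransmit_hostedStates rfl]

variable {enc : Finset (Packet n b) → List Bool}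

/-- Messages between vertices of one machine are computed locally, all others are decoded from the
packets received. By `hρ` the message addressed to `ρ u v` can stand in for the one to `v`. -/
theorem relay_step (henc : Function.Injective enc)
    (hlen : ∀ u v, (A.transmit σ u v).length ≤ b)
    (hρ : ∀ u v, u ≠ v → A.transmit σ u (ρ u v) = A.transmit σ u v) :
    (A.relay k b ρ enc).step (fun i => (h, A.hostedStates h σ i)) =
      fun i => (h, A.hostedStates h (A.step σ) i) := by
  funext i
  rw [SyncAlgorithm.step_empty]
  refine Prod.ext rfl (funext fun v => ?_)
  by_cases hv : h v = i
  · simp only [hostedStates, hv, if_true, Option.map_some, SyncAlgorithm.step]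
    congr 1
    split_ifs with ho
    · rfl
    · congr 1
      funext u
      split_ifs with h1 h2
      · rw [h1, SyncAlgorithm.transmit_self]
      · rfl
      · rw [SyncAlgorithm.transmit_empty, if_neg h2]
        change lookup (Function.invFun enc (enc _)) _ _ = _
        rw [Function.leftInverse_invFun henc]
        subst hv
        exact (lookup_packets hlen).trans (hρ u v h1)
  · simp [hostedStates, hv]

variable {G : LabeledGraph n α β} {tape : Fin k → Fin (n * A.coins) → Bool}

theorem relay_config (henc : Function.Injective enc)
    (hlen : ∀ t u v, (A.message G.view (vertexTape h tape) t u v).length ≤ b)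
    (hρ : ∀ t u v, u ≠ v → A.message G.view (vertexTape h tape) t u (ρ u v) =
      A.message G.view (vertexTape h tape) t u v) (t : ℕ) :
    (A.relay k b ρ enc).config (G.machineView h) tape t =
      fun i => (h, A.hostedStates h (A.config G.view (vertexTape h tape) t) i) := by
  induction t with
  | zero =>
    funext i
    refine Prod.ext rfl (funext fun v => ?_)
    by_cases hv : h v = i
    · subst hv
      simp [SyncAlgorithm.config, LabeledGraph.machineView, hostedStates]
      rfl
    · simp [SyncAlgorithm.config, LabeledGraph.machineView, hostedStates, hv]
  | succ t ih =>
    rw [SyncAlgorithm.config_succ, SyncAlgorithm.config_succ, ih]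
    exact relay_step henc (hlen t) (hρ t)

/-- The pairs of vertices whose messages in round `t` go from machine `i` to machine `j`. -/
def linkPairs (A : CliqueAlgorithm n α β O) (know : Fin n → VertexView n α β)
    (θ : Fin n → Fin A.coins → Bool) (h : Fin n → Fin k) (t : ℕ) (i j : Fin k) :
    Finset (Fin n × Fin n) :=
  Finset.univ.filter fun p => h p.1 = i ∧ h p.2 = j ∧ A.message know θ t p.1 p.2 ≠ []

/-- Counting distinct pairs `(u, ρ u v)` instead of `(u, v)` is what helps broadcasts: if `ρ u` is
constant, all messages from `u` to one machine share a packet. -/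
theorem relay_message_length {s : ℕ} (henc : Function.Injective enc)
    (hs : ∀ S, (enc S).length = s * S.card)
    (hlen : ∀ t u v, (A.message G.view (vertexTape h tape) t u v).length ≤ b)
    (hρ : ∀ t u v, u ≠ v → A.message G.view (vertexTape h tape) t u (ρ u v) =
      A.message G.view (vertexTape h tape) t u v) (t : ℕ) {i j : Fin k} (hij : i ≠ j) :
    ((A.relay k b ρ enc).message (G.machineView h) tape t i j).length ≤
      s * ((A.linkPairs G.view (vertexTape h tape) h t i j).image
        fun p => (p.1, ρ p.1 p.2)).card := by
  rw [SyncAlgorithm.message, relay_config henc hlen hρ, SyncAlgorithm.transmit_empty, if_neg hij,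
    hs]
  refine Nat.mul_le_mul_left _ ?_
  refine le_trans (Finset.card_le_card ?_) (Finset.card_image_le
    (f := fun p => packet b p.1 p.2 (A.message G.view (vertexTape h tape) t p.1 p.2)))
  intro x hx
  simp only [packets, linkPairs, Finset.mem_image, Finset.mem_filter, Finset.mem_univ,
    true_and] at hx ⊢
  obtain ⟨p, ⟨h1, h2, h3⟩, rfl⟩ := hx
  rw [localTransmit_hostedStates h1] at h3 ⊢
  have hne : p.1 ≠ p.2 := fun h' => hij (by rw [← h1, ← h2, h'])
  refine ⟨(p.1, ρ p.1 p.2), ⟨p, ⟨h1, h2, ?_⟩, rfl⟩, rfl⟩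
  rw [← hρ t _ _ hne]
  exact h3

end CliqueAlgorithm

/-! ### Finite probability -/

open Classical in
theorem uniformProb_eq_sum {Ω : Type} [Fintype Ω] (E : Set Ω) :
    uniformProb E = (∑ ω, if ω ∈ E then (1 : ℝ) else 0) / Fintype.card Ω := by
  rw [uniformProb, Nat.card_eq_fintype_card, Nat.card_eq_fintype_card, Finset.sum_boole,
    Fintype.card_subtype]

theorem uniformProb_mono {Ω : Type} [Finite Ω] {E F : Set Ω} (h : E ⊆ F) :
    uniformProb E ≤ uniformProb F := by
  unfold uniformProb
  gcongr
  exact Nat.card_mono (Set.toFinite F) h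

theorem uniformProb_union_le {Ω : Type} [Finite Ω] (E F : Set Ω) :
    uniformProb (E ∪ F) ≤ uniformProb E + uniformProb F := by
  unfold uniformProb
  rw [← add_div]
  gcongr
  exact_mod_cast Set.ncard_union_le E F

theorem uniformProb_biUnion_le {Ω ι : Type} [Finite Ω] (s : Finset ι) (E : ι → Set Ω) {p : ℝ}
    (h : ∀ i ∈ s, uniformProb (E i) ≤ p) :
    uniformProb {ω | ∃ i ∈ s, ω ∈ E i} ≤ s.card * p := by
  classical
  induction s using Finset.induction_on with
  | empty => simp [uniformProb]
  | insert i s hi ih =>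
    have hset : {ω | ∃ j ∈ insert i s, ω ∈ E j} = E i ∪ {ω | ∃ j ∈ s, ω ∈ E j} := by
      ext ω; simp
    rw [hset, Finset.card_insert_of_notMem hi]
    refine (uniformProb_union_le _ _).trans ?_
    have h1 := h i (Finset.mem_insert_self i s)
    have h2 := ih fun j hj => h j (Finset.mem_insert_of_mem hj)
    push_cast
    linarith

theorem uniformProb_compl {Ω : Type} [Finite Ω] [Nonempty Ω] (E : Set Ω) :
    uniformProb Eᶜ = 1 - uniformProb E := by
  have h0 : (Nat.card Ω : ℝ) ≠ 0 := by exact_mod_cast Nat.card_pos.ne'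
  have h1 : (Nat.card E : ℝ) + Nat.card (Eᶜ : Set Ω) = Nat.card Ω := by
    exact_mod_cast Set.ncard_add_ncard_compl E
  unfold uniformProb
  rw [← h1] at h0 ⊢
  field_simp
  ring

/-- Markov's inequality, with `F` dominating the indicator of `E`. -/
theorem uniformProb_le_of_sum_le {Ω : Type} [Fintype Ω] {E : Set Ω} {F : Ω → ℝ} {p : ℝ}
    (hF : ∀ ω, 0 ≤ F ω) (hE : ∀ ω ∈ E, 1 ≤ F ω) (h : ∑ ω, F ω ≤ p * Fintype.card Ω)
    (hp : 0 ≤ p) : uniformProb E ≤ p := by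
  classical
  rw [uniformProb_eq_sum]
  refine div_le_of_le_mul₀ (by positivity) hp (le_trans (Finset.sum_le_sum fun ω _ => ?_) h)
  split_ifs with hω
  · exact hE ω hω
  · exact hF ω

/-- If the conditional probability of `E` given the second component is always at least `p`, then
so is the probability of `E`. -/
theorem le_uniformProb_prod {X Y : Type} [Finite X] [Finite Y] [Nonempty X] [Nonempty Y]
    {E : Set (X × Y)} {p : ℝ} (h : ∀ y, p ≤ uniformProb {x | (x, y) ∈ E}) : p ≤ uniformProb E := by
  classical
  have := Fintype.ofFinite X
  have := Fintype.ofFinite Y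
  simp only [uniformProb_eq_sum] at h ⊢
  rw [le_div_iff₀ (by positivity), Fintype.sum_prod_type_right, Fintype.card_prod]
  calc p * ((Fintype.card X * Fintype.card Y : ℕ) : ℝ)
      = ∑ _y : Y, p * Fintype.card X := by
        rw [Finset.sum_const, Finset.card_univ, nsmul_eq_mul]; push_cast; ring
    _ ≤ _ := Finset.sum_le_sum fun y _ => by
        have := h y
        rwa [le_div_iff₀ (by positivity)] at this

theorem uniformProb_prod_snd {X Y : Type} [Finite X] [Nonempty X] (E : Set Y) :
    uniformProb {z : X × Y | z.2 ∈ E} = uniformProb E := by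
  have h : {z : X × Y | z.2 ∈ E} = Set.univ ×ˢ E := by ext z; simp
  have h0 : (Nat.card X : ℝ) ≠ 0 := by exact_mod_cast Nat.card_pos.ne'
  have h1 : Nat.card (Set.univ ×ˢ E : Set (X × Y)) = Nat.card X * Nat.card E := by
    simp
  rw [h, uniformProb, uniformProb, h1, Nat.card_prod]
  push_cast
  exact mul_div_mul_left _ _ h0

theorem uniformProb_preimage_equiv {Ω Ω' : Type} (e : Ω ≃ Ω') (E : Set Ω') :
    uniformProb (e ⁻¹' E) = uniformProb E := by
  rw [uniformProb, uniformProb, Nat.card_congr e,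
    Nat.card_preimage_of_injective e.injective (by rw [e.surjective.range_eq]; simp)]

theorem uniformProb_prod_le {X Y : Type} [Finite X] [Finite Y] [Nonempty X] [Nonempty Y]
    {E : Set (X × Y)} {p : ℝ} (h : ∀ y, uniformProb {x | (x, y) ∈ E} ≤ p) : uniformProb E ≤ p := by
  have h1 : 1 - p ≤ uniformProb Eᶜ := by
    refine le_uniformProb_prod fun y => ?_
    have h2 : {x | (x, y) ∈ Eᶜ} = {x | (x, y) ∈ E}ᶜ := rfl
    rw [h2, uniformProb_compl]
    linarith [h y]
  rw [uniformProb_compl] at h1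
  linarith

theorem uniformProb_prod_fst {X Y : Type} [Finite Y] [Nonempty Y] (E : Set X) :
    uniformProb {z : X × Y | z.1 ∈ E} = uniformProb E := by
  rw [← uniformProb_prod_snd (X := Y) E]
  exact uniformProb_preimage_equiv (Equiv.prodComm X Y) {z | z.2 ∈ E}

/-- If `f ω` can be exchanged with an independent uniform value without changing `g ω`, then it is
uniform and independent of `g ω`. -/
theorem uniformProb_preimage_of_exchange {Ω X Y : Type} [Nonempty Y] [Finite Y] (g : Ω → X)
    (f : Ω → Y) (upd : Ω → Y → Ω) (hg : ∀ ω y, g (upd ω y) = g ω) (hf : ∀ ω y, f (upd ω y) = y)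
    (hupd : ∀ ω y, upd (upd ω y) (f ω) = ω) (E : Set (X × Y)) :
    uniformProb {ω | (g ω, f ω) ∈ E} = uniformProb {z : Ω × Y | (g z.1, z.2) ∈ E} := by
  let e : Ω × Y ≃ Ω × Y :=
    ⟨fun z => (upd z.1 z.2, f z.1), fun z => (upd z.1 z.2, f z.1), fun z => by simp [hf, hupd],
      fun z => by simp [hf, hupd]⟩
  rw [← uniformProb_prod_fst (Y := Y), ← uniformProb_preimage_equiv e]
  simp [e, hf, hg, Set.preimage]

/-! ### Chernoff bounds -/

theorem exp_le_one_add_two_mul {x : ℝ} (h0 : 0 ≤ x) (h1 : x ≤ 1) : Real.exp x ≤ 1 + 2 * x := by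
  have h := Real.abs_exp_sub_one_le (x := x) (by rwa [abs_of_nonneg h0])
  rw [abs_of_nonneg h0] at h
  linarith [le_abs_self (Real.exp x - 1)]

section Chernoff

variable {V C : Type} [Fintype V] [DecidableEq V] [Fintype C] [DecidableEq C]

/-- The total weight of those `v` for which `g v` is in `Q v`. -/
def hitWeight (w : V → ℝ) (Q : V → Finset C) (g : V → C) : ℝ :=
  ∑ v, if g v ∈ Q v then w v else 0

/-- The coordinates of a uniform `g` are independent, so the exponential moment at `1 / a`
factorises. As `w v / a ≤ 1`, each factor is at most `1 + 2 * (q / |C|) * (w v / a)`, hence at most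
the exponential of the increment. -/
theorem sum_exp_hitWeight_le {w : V → ℝ} {Q : V → Finset C} {a : ℝ} {q : ℕ} (ha : 0 < a)
    (hw : ∀ v, 0 ≤ w v) (hwa : ∀ v, w v ≤ a) (hQ : ∀ v, (Q v).card ≤ q) :
    ∑ g : V → C, Real.exp (hitWeight w Q g / a) ≤
      Real.exp (2 * q * (∑ v, w v) / (Fintype.card C * a)) * Fintype.card (V → C) := by
  have h1 : ∀ g : V → C, Real.exp (hitWeight w Q g / a) =
      ∏ v, if g v ∈ Q v then Real.exp (w v / a) else 1 := by
    intro g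
    rw [hitWeight, Finset.sum_div, Real.exp_sum]
    refine Finset.prod_congr rfl fun v _ => ?_
    split_ifs <;> simp
  have h2 : ∑ g : V → C, Real.exp (hitWeight w Q g / a) =
      ∏ v, ∑ c, if c ∈ Q v then Real.exp (w v / a) else 1 := by
    simp only [h1]
    rw [Finset.prod_univ_sum, Fintype.piFinset_univ]
  have h3 : ∀ v, (∑ c, if c ∈ Q v then Real.exp (w v / a) else 1) ≤
      Fintype.card C * Real.exp (2 * q * w v / (Fintype.card C * a)) := by
    intro v
    rcases isEmpty_or_nonempty C with hC | hC
    · simp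
    have hx0 : 0 ≤ w v / a := div_nonneg (hw v) ha.le
    have hx1 : w v / a ≤ 1 := (div_le_one ha).2 (hwa v)
    have hk : (0 : ℝ) < Fintype.card C := by exact_mod_cast Fintype.card_pos
    have hq : ((Q v).card : ℝ) ≤ q := by exact_mod_cast hQ v
    calc (∑ c, if c ∈ Q v then Real.exp (w v / a) else 1)
        ≤ ∑ c, (1 + if c ∈ Q v then 2 * (w v / a) else 0) := by
          refine Finset.sum_le_sum fun c _ => ?_
          split_ifs
          · exact exp_le_one_add_two_mul hx0 hx1
          · simp
      _ = Fintype.card C + (Q v).card * (2 * (w v / a)) := by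
          rw [Finset.sum_add_distrib, ← Finset.sum_filter]
          simp
      _ ≤ Fintype.card C + q * (2 * (w v / a)) := by gcongr
      _ = Fintype.card C * (2 * q * w v / (Fintype.card C * a) + 1) := by
          field_simp
          ring
      _ ≤ _ := by
          gcongr
          exact Real.add_one_le_exp _
  rw [h2]
  refine (Finset.prod_le_prod (fun v _ => ?_) fun v _ => h3 v).trans_eq ?_
  · refine Finset.sum_nonneg fun c _ => ?_
    split_ifs <;> positivity
  · rw [Finset.prod_mul_distrib, ← Real.exp_sum, Finset.prod_const, Finset.card_univ,
      Fintype.card_fun, mul_comm, Finset.mul_sum, Finset.sum_div]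
    push_cast
    rfl

/-- Markov's inequality for the exponential moment. The threshold is twice the bound on the mean,
because of `exp x ≤ 1 + 2 * x`, plus a deviation `a * τ`. -/
theorem uniformProb_hitWeight_ge {w : V → ℝ} {Q : V → Finset C} {a : ℝ} {q : ℕ} (ha : 0 < a)
    (hw : ∀ v, 0 ≤ w v) (hwa : ∀ v, w v ≤ a) (hQ : ∀ v, (Q v).card ≤ q) (τ : ℝ) :
    uniformProb {g : V → C | 2 * q * (∑ v, w v) / Fintype.card C + a * τ ≤ hitWeight w Q g} ≤
      Real.exp (-τ) := by
  set μ := 2 * q * (∑ v, w v) / Fintype.card C with hμ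
  refine uniformProb_le_of_sum_le (F := fun g => Real.exp (hitWeight w Q g / a - μ / a - τ))
    (fun g => (Real.exp_pos _).le) (fun g hg => ?_) ?_ (Real.exp_pos _).le
  · rw [Real.one_le_exp_iff]
    have : (μ + a * τ) / a ≤ hitWeight w Q g / a := by
      gcongr
      exact hg
    rw [add_div, mul_div_cancel_left₀ _ ha.ne'] at this
    linarith
  · have h := sum_exp_hitWeight_le ha hw hwa hQ
    rw [← div_div, ← hμ] at h
    calc ∑ g : V → C, Real.exp (hitWeight w Q g / a - μ / a - τ)
        = Real.exp (-(μ / a) - τ) * ∑ g : V → C, Real.exp (hitWeight w Q g / a) := by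
          rw [Finset.mul_sum]
          refine Finset.sum_congr rfl fun g _ => ?_
          rw [← Real.exp_add]
          congr 1
          ring
      _ ≤ Real.exp (-(μ / a) - τ) * (Real.exp (μ / a) * Fintype.card (V → C)) := by gcongr
      _ = _ := by
          rw [← mul_assoc, ← Real.exp_add]
          congr 2
          ring

end Chernoff

/-! ### The load of a link under a random partition -/

section LinkLoad

variable {V : Type} {k : ℕ}

/-- The partition `h`, resampled according to `g` outside of the class `i`. -/
def resample (i : Fin k) (h g : V → Fin k) (v : V) : Fin k :=
  if h v ≠ i ∧ g v ≠ i then g v else h v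

theorem resample_eq_iff {i : Fin k} {h g : V → Fin k} (v : V) :
    resample i h g v = i ↔ h v = i := by
  unfold resample
  split_ifs with hv
  · simp [hv.1, hv.2]
  · rfl

/-- Resampling exchanges `h v` and `g v` wherever neither is `i`, so doing it to both members of a
pair is an involution. -/
theorem resample_resample (i : Fin k) (h g : V → Fin k) :
    resample i (resample i h g) (resample i g h) = h := by
  funext v
  simp only [resample]
  by_cases h1 : h v = i <;> by_cases h2 : g v = i <;> simp [h1, h2]

variable [Fintype V]

theorem uniformProb_classSize_ge [DecidableEq V] (S : Finset V) (i : Fin k) (τ : ℝ) :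
    uniformProb {h : V → Fin k |
      2 * (S.card : ℝ) / k + τ ≤ (S.filter fun u => h u = i).card} ≤ Real.exp (-τ) := by
  have := uniformProb_hitWeight_ge (w := fun u => if u ∈ S then 1 else 0)
    (Q := fun _ => ({i} : Finset (Fin k))) (a := 1) (q := 1) one_pos
    (fun u => by split_ifs <;> norm_num) (fun u => by split_ifs <;> norm_num) (by simp) τ
  refine le_trans (uniformProb_mono fun h hh => ?_) this
  have h1 : hitWeight (fun u => if u ∈ S then 1 else 0) (fun _ => ({i} : Finset (Fin k))) h =
      (S.filter fun u => h u = i).card := by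
    simp only [hitWeight, Finset.mem_singleton]
    rw [Finset.card_filter, Nat.cast_sum, ← Finset.sum_subset (Finset.subset_univ S)]
    · refine Finset.sum_congr rfl fun u hu => ?_
      simp [hu]
    · intro u _ hu
      simp [hu]
  simp only [Set.mem_ofPred_eq, h1] at hh ⊢
  simpa using hh

variable (R : V → V → Prop) [DecidableRel R]

/-- The number of edges from the class `i` of the partition `h` to `v`. -/
def inCount (i : Fin k) (h : V → Fin k) (v : V) : ℝ :=
  hitWeight (fun u => if R u v then 1 else 0) (fun _ => {i}) h

theorem inCount_nonneg (i : Fin k) (h : V → Fin k) (v : V) : 0 ≤ inCount R i h v := by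
  refine Finset.sum_nonneg fun u _ => ?_
  dsimp only
  split_ifs <;> norm_num

theorem inCount_congr {i : Fin k} {h g : V → Fin k} (hg : ∀ u, g u = i ↔ h u = i) :
    inCount R i g = inCount R i h := by
  funext v
  simp [inCount, hitWeight, hg]

theorem sum_inCount (i : Fin k) (h : V → Fin k) :
    ∑ v, inCount R i h v =
      hitWeight (fun u => ((Finset.univ.filter (R u)).card : ℝ)) (fun _ => {i}) h := by
  simp only [inCount, hitWeight]
  rw [Finset.sum_comm]
  refine Finset.sum_congr rfl fun u _ => ?_
  split_ifs <;> simp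

theorem card_link_eq_sum_inCount (i j : Fin k) (h : V → Fin k) :
    ((Finset.univ.filter fun p : V × V => h p.1 = i ∧ h p.2 = j ∧ R p.1 p.2).card : ℝ) =
      ∑ v, if h v = j then inCount R i h v else 0 := by
  rw [Finset.card_filter, Fintype.sum_prod_type_right]
  push_cast
  refine Finset.sum_congr rfl fun v _ => ?_
  simp only [inCount, hitWeight, Finset.mem_singleton]
  split_ifs with hv
  · refine Finset.sum_congr rfl fun u _ => ?_
    by_cases hu : h u = i <;> simp [hv, hu]
  · simp [hv]

/-- This replaces conditioning on the class `i`: the resampled partition is uniform, yet for fixed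
`h` its class `i` is fixed while the other vertices move with the independent `g`. -/
theorem uniformProb_resample [DecidableEq V] [NeZero k] (i : Fin k) (E : Set (V → Fin k)) :
    uniformProb {z : (V → Fin k) × (V → Fin k) | resample i z.2 z.1 ∈ E} = uniformProb E := by
  let f : (V → Fin k) × (V → Fin k) → (V → Fin k) × (V → Fin k) :=
    fun z => (resample i z.1 z.2, resample i z.2 z.1)
  have hf : Function.Involutive f := fun z =>
    Prod.ext (resample_resample i z.1 z.2) (resample_resample i z.2 z.1)
  rw [← uniformProb_prod_snd (X := V → Fin k) E]
  exact uniformProb_preimage_equiv (hf.toPerm f) {z | z.2 ∈ E}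

/-- The load is the sum of `inCount R i h v` over the class `j`. These weights depend only on the
class `i`. Unless one weight or their total is exceptionally large (`bad₁`, `bad₂`), fix the class
`i`, resample the rest and apply the Chernoff bound again (`bad₃`). -/
theorem uniformProb_linkLoad_ge [DecidableEq V] [NeZero k] {D : ℕ} (hD : 1 ≤ D)
    (hout : ∀ u, (Finset.univ.filter (R u)).card ≤ D)
    (hin : ∀ v, (Finset.univ.filter fun u => R u v).card ≤ D) {i j : Fin k} (hij : i ≠ j)
    {τ : ℝ} (hτ : 0 < τ) :
    uniformProb {h : V → Fin k |
      8 * ((Finset.univ.filter fun p : V × V => R p.1 p.2).card : ℝ) / (k : ℝ) ^ 2 +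
        6 * D * τ / k + τ ^ 2 ≤
      ((Finset.univ.filter fun p : V × V => h p.1 = i ∧ h p.2 = j ∧ R p.1 p.2).card : ℝ)} ≤
      (Fintype.card V + 2) * Real.exp (-τ) := by
  have hk : (0 : ℝ) < k := by exact_mod_cast Nat.pos_of_ne_zero (NeZero.ne k)
  have hD' : (1 : ℝ) ≤ D := by exact_mod_cast hD
  set m : ℝ := ((Finset.univ.filter fun p : V × V => R p.1 p.2).card : ℝ) with hm
  have hm' : m = ∑ u, ((Finset.univ.filter (R u)).card : ℝ) := by
    rw [hm, Finset.card_filter, Fintype.sum_prod_type]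
    push_cast
    refine Finset.sum_congr rfl fun u _ => ?_
    simp
  set a : ℝ := 2 * D / k + τ with ha
  have ha0 : 0 < a := by positivity
  set bad₁ : Set (V → Fin k) := {h | ∃ v ∈ Finset.univ, h ∈ {h | a ≤ inCount R i h v}} with hb1
  set bad₂ : Set (V → Fin k) := {h | 2 * m / k + D * τ ≤ ∑ v, inCount R i h v} with hb2
  set bad₃ : Set (V → Fin k) := {h | h ∉ bad₁ ∧ h ∉ bad₂ ∧ 8 * m / (k : ℝ) ^ 2 +
    6 * D * τ / k + τ ^ 2 ≤ ∑ v, if h v = j then inCount R i h v else 0} with hb3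
  have p1 : uniformProb bad₁ ≤ Fintype.card V * Real.exp (-τ) := by
    refine uniformProb_biUnion_le _ _ fun v _ => ?_
    refine le_trans (uniformProb_mono fun h hh => ?_)
      (uniformProb_hitWeight_ge (w := fun u => if R u v then 1 else 0)
        (Q := fun _ => ({i} : Finset (Fin k))) (a := 1) (q := 1) one_pos
        (fun u => by split_ifs <;> norm_num) (fun u => by split_ifs <;> norm_num) (by simp) τ)
    refine le_trans ?_ (show a ≤ inCount R i h v from hh)
    have h2 : ((Finset.univ.filter fun u => R u v).card : ℝ) ≤ D := by exact_mod_cast hin v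
    simp only [Finset.sum_boole, Nat.cast_one, mul_one, one_mul, Fintype.card_fin, ha]
    gcongr
  have p2 : uniformProb bad₂ ≤ Real.exp (-τ) := by
    refine le_trans (uniformProb_mono fun h hh => ?_)
      (uniformProb_hitWeight_ge (w := fun u => ((Finset.univ.filter (R u)).card : ℝ))
        (Q := fun _ => ({i} : Finset (Fin k))) (a := D) (q := 1) (by linarith)
        (fun u => by positivity) (fun u => by exact_mod_cast hout u) (by simp) τ)
    simp only [hb2, Set.mem_ofPred_eq, sum_inCount] at hh
    simpa [← hm'] using hh
  have p3 : uniformProb bad₃ ≤ Real.exp (-τ) := by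
    rw [← uniformProb_resample i bad₃]
    refine uniformProb_prod_le fun h => ?_
    by_cases hgood : h ∉ bad₁ ∧ h ∉ bad₂
    · simp only [hb1, hb2, Set.mem_ofPred_eq, Finset.mem_univ, true_and, not_exists, not_le] at hgood
      refine le_trans (uniformProb_mono fun g hg => ?_)
        (uniformProb_hitWeight_ge (w := inCount R i h)
          (Q := fun _ => ({i, j} : Finset (Fin k))) (a := a) (q := 2) ha0
          (inCount_nonneg R i h) (fun v => (hgood.1 v).le) (fun _ => Finset.card_le_two) τ)
      have h3 := hg.2.2
      rw [inCount_congr R resample_eq_iff] at h3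
      have h4 : (∑ v, if resample i h g v = j then inCount R i h v else 0) ≤
          hitWeight (inCount R i h) (fun _ => ({i, j} : Finset (Fin k))) g := by
        refine Finset.sum_le_sum fun v _ => ?_
        have h0 := inCount_nonneg R i h v
        by_cases h5 : resample i h g v = j
        · have h6 : g v ∈ ({i, j} : Finset (Fin k)) := by
            simp only [Finset.mem_insert, Finset.mem_singleton]
            by_contra hn
            rw [not_or] at hn
            have : h v ≠ i := fun h' => hij (by
              rw [← h5]; exact ((resample_eq_iff v).2 h').symm)
            rw [resample, if_pos ⟨this, hn.1⟩] at h5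
            exact hn.2 h5
          rw [if_pos h5, if_pos h6]
        · rw [if_neg h5]
          split_ifs <;> simp [h0]
      refine le_trans ?_ (h3.trans h4)
      have h7 := hgood.2.le
      calc 2 * ((2 : ℕ) : ℝ) * (∑ v, inCount R i h v) / (Fintype.card (Fin k) : ℝ) + a * τ
          ≤ 2 * ((2 : ℕ) : ℝ) * (2 * m / k + D * τ) / (k : ℝ) + a * τ := by
            rw [Fintype.card_fin]; gcongr
        _ = _ := by
            rw [ha]; push_cast; field_simp; ring
    -- Resampling preserves the class `i`, hence also membership in `bad₁` and `bad₂`.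
    · have : {g : V → Fin k | (g, h) ∈ {z : (V → Fin k) × (V → Fin k) |
          resample i z.2 z.1 ∈ bad₃}} = ∅ := by
        refine Set.eq_empty_of_forall_notMem fun g hg => hgood ?_
        have h1 := hg.1
        have h2 := hg.2.1
        simp only [hb1, hb2, Set.mem_ofPred_eq, inCount_congr R resample_eq_iff] at h1 h2 ⊢
        exact ⟨h1, h2⟩
      rw [this]
      simp [uniformProb, (Real.exp_pos _).le]
  have hsub : {h : V → Fin k | 8 * m / (k : ℝ) ^ 2 + 6 * D * τ / k + τ ^ 2 ≤
      ((Finset.univ.filter fun p : V × V => h p.1 = i ∧ h p.2 = j ∧ R p.1 p.2).card : ℝ)} ⊆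
      bad₁ ∪ bad₂ ∪ bad₃ := by
    intro h hh
    simp only [Set.mem_ofPred_eq, card_link_eq_sum_inCount] at hh
    by_cases h1 : h ∈ bad₁
    · exact Or.inl (Or.inl h1)
    by_cases h2 : h ∈ bad₂
    · exact Or.inl (Or.inr h2)
    · exact Or.inr ⟨h1, h2, hh⟩
  have h1 := uniformProb_mono hsub
  have h2 := uniformProb_union_le (bad₁ ∪ bad₂) bad₃
  have h3 := uniformProb_union_le bad₁ bad₂
  linarith

end LinkLoad

/-! ### The simulation -/

namespace SyncAlgorithm

variable {N K Out : Type} [DecidableEq N] (A : SyncAlgorithm N K Out) {know : N → K}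
  {tape : N → Fin A.coins → Bool}

theorem outputAt_of_le {t t' : ℕ} (h : t ≤ t') {u : N} {o : Out}
    (ho : A.outputAt know tape t u = some o) : A.outputAt know tape t' u = some o := by
  induction t', h using Nat.le_induction with
  | base => exact ho
  | succ t' _ ih =>
    have h1 : A.config know tape (t' + 1) u = A.config know tape t' u := by
      rw [config_succ, step, if_pos]
      rw [outputAt] at ih
      simp [ih]
    rw [outputAt, h1]
    exact ih

theorem message_eq_nil_of_haltsBy {t t' : ℕ} (h : t ≤ t') (hh : A.HaltsBy know tape t) (u v : N) :
    A.message know tape t' u v = [] := by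
  obtain ⟨o, ho⟩ := Option.isSome_iff_exists.1 (hh u)
  have := A.outputAt_of_le h ho
  rw [outputAt] at this
  simp [message, transmit, this]

/-- The next state of `u` after a round in which it receives nothing. -/
def silentStep (u : N) (s : A.State) : A.State :=
  if (A.output u s).isSome then s else A.receive u s fun _ => []

/-- The algorithm that performs `T` silent rounds of `A` at once. -/
@[reducible] def skipRounds (T : ℕ) : SyncAlgorithm N K Out :=
  { A with init := fun u κ tape => (A.silentStep u)^[T] (A.init u κ tape) }

/-- Without messages every node evolves on its own, so `T` rounds are mere local computation. -/
theorem skipRounds_config_zero {T : ℕ} (h : ∀ t u v, A.message know tape t u v = []) :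
    (A.skipRounds T).config know tape 0 = A.config know tape T := by
  have key : ∀ t u, A.config know tape t u =
      (A.silentStep u)^[t] (A.init u (know u) (tape u)) := by
    intro t
    induction t with
    | zero => exact fun u => rfl
    | succ t ih =>
      intro u
      have h2 : (fun v => A.transmit (A.config know tape t) v u) = fun _ => [] :=
        funext fun v => h t v u
      rw [Function.iterate_succ_apply', ← ih, config_succ, step, h2, silentStep]
  funext u
  exact (key T u).symm

end SyncAlgorithm

namespace CliqueAlgorithm

variable {n k : ℕ} {α β O : Type} (A : CliqueAlgorithm n α β O) {P : GraphProblem n α β O}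

/-- The output configuration of `A` after `T` rounds is feasible with probability `1 - ε`. -/
def HasErrorAt (P : GraphProblem n α β O) (ε : ℝ) (T : ℕ) : Prop :=
  ∀ G ∈ P.domain, 1 - ε ≤ uniformProb {θ : Fin n → Fin A.coins → Bool |
    ∃ o : Fin n → O, P.feasible G o ∧ ∀ v, A.outputAt G.view θ T v = some (o v)}

variable {A}

/-- Outputs are irrevocable, so they may all be read off at the common time `T`. -/
theorem HasError.hasErrorAt {ε : ℝ} {T : ℕ} (h : HasError A P ε) (hT : TimeAtMost A P T) :
    A.HasErrorAt P ε T := by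
  intro G hG
  refine (h G hG).trans (uniformProb_mono ?_)
  rintro θ ⟨t, o, ho, hout⟩
  refine ⟨o, ho, fun v => ?_⟩
  rcases le_total t T with htT | hTt
  · exact A.outputAt_of_le htT (hout v)
  · obtain ⟨x, hx⟩ := Option.isSome_iff_exists.1 (hT G hG θ v)
    rw [hx, ← hout v]
    exact (A.outputAt_of_le hTt hx).symm

/-- Vertex `v` reads block `v` of its home machine's coins. Exchanging exactly these blocks with an
independent `θ` leaves the partition unchanged. -/
theorem uniformProb_vertexTape {c : ℕ}
    {E : Set ((Fin n → Fin k) × (Fin n → Fin c → Bool))} :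
    uniformProb {ω : (Fin n → Fin k) × (Fin k → Fin (n * c) → Bool) |
      (ω.1, vertexTape ω.1 ω.2) ∈ E} =
    uniformProb {z : ((Fin n → Fin k) × (Fin k → Fin (n * c) → Bool)) × (Fin n → Fin c → Bool) |
      (z.1.1, z.2) ∈ E} := by
  refine uniformProb_preimage_of_exchange (fun ω => ω.1) (fun ω => vertexTape ω.1 ω.2)
    (fun (ω : (Fin n → Fin k) × (Fin k → Fin (n * c) → Bool)) θ => (ω.1, fun i x =>
      if ω.1 (finProdFinEquiv.symm x).1 = i then
        θ (finProdFinEquiv.symm x).1 (finProdFinEquiv.symm x).2 else ω.2 i x))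
    (fun _ _ => rfl) (fun ω θ => ?_) (fun ω θ => ?_) E
  · funext v x
    simp [vertexTape]
  · refine Prod.ext rfl ?_
    funext i x
    simp only
    split_ifs with h
    · rw [vertexTape, h, Prod.mk.eta, Equiv.apply_symm_apply]
    · rfl

/-- The algorithm in the `k`-machine model with bandwidth `W` that simulates `T` rounds of `A`. -/
@[reducible] def simulate (A : CliqueAlgorithm n α β O) (k b : ℕ) (ρ : Fin n → Fin n → Fin n)
    (enc : Finset (Packet n b) → List Bool) (T W : ℕ) : KMachineAlgorithm n k α β O :=
  (A.relay k b ρ enc).throttle (fun _ st v => (st.2 v).bind (A.output v)) T W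

/-- The number of packets that machine `i` sends to machine `j` in the simulation of round `t`. -/
def linkLoad (A : CliqueAlgorithm n α β O) (ρ : Fin n → Fin n → Fin n)
    (know : Fin n → VertexView n α β) (θ : Fin n → Fin A.coins → Bool) (h : Fin n → Fin k)
    (t : ℕ) (i j : Fin k) : ℕ :=
  ((A.linkPairs know θ h t i j).image fun p => (p.1, ρ p.1 p.2)).card

section Simulate

variable {b s T W : ℕ} {ρ : Fin n → Fin n → Fin n} {enc : Finset (Packet n b) → List Bool}

theorem simulate_output (henc : Function.Injective enc) (hs : ∀ S, (enc S).length = s * S.card)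
    (hW : 1 ≤ W) (hlen : MessageSizeAtMost A P b)
    (hρ : ∀ G ∈ P.domain, ∀ tape t u v, u ≠ v →
      A.message G.view tape t u (ρ u v) = A.message G.view tape t u v)
    {G : LabeledGraph n α β} (hG : G ∈ P.domain) (h : Fin n → Fin k)
    (tape : Fin k → Fin (n * A.coins) → Bool) (L : ℕ → ℕ)
    (hL : ∀ r < T, ∀ i j, i ≠ j → A.linkLoad ρ G.view (vertexTape h tape) h r i j ≤ L r) :
    ∃ t ≤ ∑ r ∈ Finset.range T, 4 * (s * L r / W + 1), ∀ i,
      (A.simulate k b ρ enc T W).outputAt (G.machineView h) tape t i =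
        some fun v => if h v = i then A.outputAt G.view (vertexTape h tape) T v else none := by
  have hlen' := hlen G hG (vertexTape h tape)
  have hρ' := hρ G hG (vertexTape h tape)
  obtain ⟨t, ht, hout⟩ := (A.relay k b ρ enc).throttle_output
    (fun _ st v => (st.2 v).bind (A.output v)) W (T := T) (G.machineView h) tape hW
    (fun r => s * L r) (fun r hr i j => by
      by_cases hij : i = j
      · rw [hij, SyncAlgorithm.message, SyncAlgorithm.transmit_self]
        simp
      · exact (relay_message_length henc hs hlen' hρ' r hij).trans
          (Nat.mul_le_mul_left _ (hL r hr i j hij)))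
  refine ⟨t, ht, fun i => ?_⟩
  rw [hout i, relay_config henc hlen' hρ']
  congr 1
  funext v
  by_cases hv : h v = i <;> simp [hostedStates, hv, SyncAlgorithm.outputAt]

theorem simulate_hasError [NeZero k] (henc : Function.Injective enc)
    (hs : ∀ S, (enc S).length = s * S.card)
    (hW : 1 ≤ W) (hlen : MessageSizeAtMost A P b)
    (hρ : ∀ G ∈ P.domain, ∀ tape t u v, u ≠ v →
      A.message G.view tape t u (ρ u v) = A.message G.view tape t u v)
    {ε : ℝ} (hε : A.HasErrorAt P ε T) :
    KMachineAlgorithm.HasError (A.simulate k b ρ enc T W) P ε := by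
  intro G hG
  refine (hε G hG).trans ?_
  rw [← uniformProb_prod_snd (X := (Fin n → Fin k) × (Fin k → Fin (n * A.coins) → Bool))]
  refine le_trans (le_of_eq ?_) (uniformProb_mono
    (E := {ω : (Fin n → Fin k) × (Fin k → Fin (n * A.coins) → Bool) |
      (ω.1, vertexTape ω.1 ω.2) ∈ {z : (Fin n → Fin k) × (Fin n → Fin A.coins → Bool) |
        ∃ o : Fin n → O, P.feasible G o ∧ ∀ v, A.outputAt G.view z.2 T v = some (o v)}}) ?_)
  · rw [uniformProb_vertexTape]
    rfl
  · rintro ⟨h, tape⟩ ⟨o, ho, hout⟩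
    obtain ⟨t, -, ht⟩ := simulate_output (k := k) (T := T) henc hs hW hlen hρ hG h tape
      -- Correctness needs only some bound on the loads, so their sum will do.
      (fun r => ∑ i, ∑ j, A.linkLoad ρ G.view (vertexTape h tape) h r i j) (fun r _ i j _ =>
        (Finset.single_le_sum (f := fun j => A.linkLoad ρ G.view (vertexTape h tape) h r i j)
          (fun _ _ => Nat.zero_le _) (Finset.mem_univ j)).trans
        (Finset.single_le_sum
          (f := fun i => ∑ j, A.linkLoad ρ G.view (vertexTape h tape) h r i j)
          (fun _ _ => Nat.zero_le _) (Finset.mem_univ i)))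
    refine ⟨t, o, ho, fun i => ?_, fun v => ⟨_, ht (h v), ?_⟩⟩
    · rw [ht i]; rfl
    · rw [if_pos rfl]; exact hout v

/-- With `θ` fixed, the loads depend on the partition alone; the bound for each `θ` is then
averaged. -/
theorem simulate_time [NeZero k] (henc : Function.Injective enc)
    (hs : ∀ S, (enc S).length = s * S.card)
    (hW : 1 ≤ W) (hlen : MessageSizeAtMost A P b)
    (hρ : ∀ G ∈ P.domain, ∀ tape t u v, u ≠ v →
      A.message G.view tape t u (ρ u v) = A.message G.view tape t u v)
    {τ : ℝ} (h : ∀ G ∈ P.domain, ∀ θ, ∃ load : ℕ → ℝ, (∀ r, 0 ≤ load r) ∧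
      ∑ r ∈ Finset.range T, 4 * (s * load r / W + 1) ≤ τ ∧
      1 - 1 / (n : ℝ) ≤ uniformProb {h : Fin n → Fin k |
        ∀ r < T, ∀ i j, i ≠ j → (A.linkLoad ρ G.view θ h r i j : ℝ) ≤ load r}) :
    KMachineAlgorithm.TimeAtMostWhp (A.simulate k b ρ enc T W) P τ := by
  intro G hG
  choose load hload0 hloadτ hload using h G hG
  let E : Set ((Fin n → Fin k) × (Fin n → Fin A.coins → Bool)) :=
    {z | ∀ r < T, ∀ i j, i ≠ j → (A.linkLoad ρ G.view z.2 z.1 r i j : ℝ) ≤ load z.2 r}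
  have hE : 1 - 1 / (n : ℝ) ≤ uniformProb
      {ω : (Fin n → Fin k) × (Fin k → Fin (n * A.coins) → Bool) |
        (ω.1, vertexTape ω.1 ω.2) ∈ E} := by
    rw [uniformProb_vertexTape]
    refine le_uniformProb_prod fun θ => ?_
    refine (hload θ).trans_eq ?_
    exact (uniformProb_prod_fst (Y := Fin k → Fin (n * A.coins) → Bool)
      {h : Fin n → Fin k | (h, θ) ∈ E}).symm
  refine hE.trans (uniformProb_mono ?_)
  rintro ⟨h, tape⟩ hω
  set θ := vertexTape h tape with hθ
  obtain ⟨t, ht, hout⟩ := simulate_output (k := k) (T := T) henc hs hW hlen hρ hG h tape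
    (fun r => ⌊load θ r⌋₊) (fun r hr i j hij => Nat.le_floor (hω r hr i j hij))
  refine ⟨t, le_trans ?_ (hloadτ θ), fun i => by rw [hout i]; rfl⟩
  refine (Nat.cast_le (α := ℝ).2 ht).trans ?_
  push_cast
  refine Finset.sum_le_sum fun r _ => ?_
  have h1 : ((s * ⌊load θ r⌋₊ / W : ℕ) : ℝ) ≤ s * load θ r / W := by
    refine Nat.cast_div_le.trans ?_
    push_cast
    gcongr
    exact Nat.floor_le (hload0 θ r)
  linarith

end Simulate

end CliqueAlgorithm

/-! ### Running time of the simulation. -/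

namespace CliqueAlgorithm

variable {n k : ℕ} {α β O : Type} {A : CliqueAlgorithm n α β O} {P : GraphProblem n α β O}
  {b s T W : ℕ} {ρ : Fin n → Fin n → Fin n} {enc : Finset (Packet n b) → List Bool}
  {know : Fin n → VertexView n α β} {θ : Fin n → Fin A.coins → Bool}

/-- There are at most `n ^ 2 * k ^ 2 ≤ n ^ 4` triples of a round and a link, each failing with
probability at most `(n + 2) / n ^ 7`; the sum is at most `1 / n` as `n + 2 ≤ n ^ 2`. -/
theorem linkLoad_le_whp [NeZero k] (hn : 2 ≤ n) (hkn : k ≤ n) (hT : T ≤ n ^ 2) {load : ℕ → ℝ}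
    (h : ∀ r, ∀ i j, i ≠ j → uniformProb {h : Fin n → Fin k |
      load r ≤ A.linkLoad ρ know θ h r i j} ≤ (n + 2) * Real.exp (-(7 * Real.log n))) :
    1 - 1 / (n : ℝ) ≤ uniformProb {h : Fin n → Fin k |
      ∀ r < T, ∀ i j, i ≠ j → (A.linkLoad ρ know θ h r i j : ℝ) ≤ load r} := by
  have hn' : (2 : ℝ) ≤ n := by exact_mod_cast hn
  have hexp : Real.exp (-(7 * Real.log n)) = ((n : ℝ) ^ 7)⁻¹ := by
    rw [Real.exp_neg, mul_comm, Real.exp_mul, Real.exp_log (by linarith)]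
    norm_cast
  let idx : Finset (ℕ × Fin k × Fin k) :=
    (Finset.range T ×ˢ Finset.univ).filter fun x => x.2.1 ≠ x.2.2
  have hidx : (idx.card : ℝ) ≤ (n : ℝ) ^ 4 := by
    have h1 : idx.card ≤ T * (k * k) := by
      refine (Finset.card_filter_le _ _).trans ?_
      simp
    have h2 : T * (k * k) ≤ n ^ 2 * (n * n) := by gcongr
    calc (idx.card : ℝ) ≤ ((n ^ 2 * (n * n) : ℕ) : ℝ) := by exact_mod_cast h1.trans h2
      _ = (n : ℝ) ^ 4 := by push_cast; ring
  have hbad := uniformProb_biUnion_le idx (fun x => {h : Fin n → Fin k |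
    load x.1 ≤ A.linkLoad ρ know θ h x.1 x.2.1 x.2.2}) (fun x hx => by
      exact h x.1 x.2.1 x.2.2 (Finset.mem_filter.1 hx).2)
  have hsub : {h : Fin n → Fin k | ∃ x ∈ idx, h ∈ {h : Fin n → Fin k |
      load x.1 ≤ A.linkLoad ρ know θ h x.1 x.2.1 x.2.2}}ᶜ ⊆ {h : Fin n → Fin k |
      ∀ r < T, ∀ i j, i ≠ j → (A.linkLoad ρ know θ h r i j : ℝ) ≤ load r} := by
    intro h hh r hr i j hij
    by_contra hcon
    refine hh ⟨(r, i, j), ?_, (not_le.1 hcon).le⟩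
    simp [idx, hr, hij]
  refine le_trans ?_ (uniformProb_mono hsub)
  rw [uniformProb_compl]
  have hfin : (n : ℝ) ^ 4 * ((n + 2) * ((n : ℝ) ^ 7)⁻¹) ≤ 1 / n := by
    have h0 : (n : ℝ) ≠ 0 := by linarith
    calc (n : ℝ) ^ 4 * (((n : ℝ) + 2) * ((n : ℝ) ^ 7)⁻¹)
        = ((n : ℝ) + 2) / (n : ℝ) ^ 2 * (1 / (n : ℝ)) := by
          field_simp
      _ ≤ 1 * (1 / (n : ℝ)) := by
          gcongr
          rw [div_le_one (by positivity)]
          nlinarith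
      _ = 1 / (n : ℝ) := one_mul _
  rw [hexp] at hbad
  have : (idx.card : ℝ) * ((n + 2) * ((n : ℝ) ^ 7)⁻¹) ≤
      (n : ℝ) ^ 4 * ((n + 2) * ((n : ℝ) ^ 7)⁻¹) := by gcongr
  linarith

theorem linkLoad_le_card_linkPairs (h : Fin n → Fin k) (t : ℕ) (i j : Fin k) :
    A.linkLoad ρ know θ h t i j ≤ (A.linkPairs know θ h t i j).card := by
  unfold linkLoad
  exact Finset.card_image_le

theorem linkLoad_le_of_broadcast (hρ : ∀ u v w, ρ u v = ρ u w) (h : Fin n → Fin k) (t : ℕ)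
    (i j : Fin k) : A.linkLoad ρ know θ h t i j ≤ ((Finset.univ.filter
      (fun u : Fin n => ∃ v, A.message know θ t u v ≠ [])).filter fun u => h u = i).card := by
  unfold linkLoad
  refine le_trans (Finset.card_le_card ?_) (Finset.card_image_le (f := fun u => (u, ρ u u)))
  intro x hx
  simp only [linkPairs, Finset.mem_image, Finset.mem_filter, Finset.mem_univ, true_and] at hx ⊢
  obtain ⟨p, ⟨h1, -, h3⟩, rfl⟩ := hx
  exact ⟨p.1, ⟨⟨p.2, h3⟩, h1⟩, by rw [hρ p.1 p.1 p.2]⟩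

theorem uniformProb_linkLoad_ge_of_degree [NeZero k] {D : ℕ} (hD : 1 ≤ D) {t : ℕ}
    (hdeg : ∀ u, (Finset.univ.filter (fun v => A.message know θ t u v ≠ [])).card ≤ D ∧
      (Finset.univ.filter (fun v => A.message know θ t v u ≠ [])).card ≤ D)
    {i j : Fin k} (hij : i ≠ j) {τ : ℝ} (hτ : 0 < τ) :
    uniformProb {h : Fin n → Fin k |
      8 * ((Finset.univ.filter
        (fun p : Fin n × Fin n => A.message know θ t p.1 p.2 ≠ [])).card : ℝ) / (k : ℝ) ^ 2 +
        6 * D * τ / k + τ ^ 2 ≤ A.linkLoad ρ know θ h t i j} ≤ (n + 2) * Real.exp (-τ) := by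
  have := uniformProb_linkLoad_ge (k := k) (fun u v => A.message know θ t u v ≠ []) hD
    (fun u => (hdeg u).1) (fun u => (hdeg u).2) hij hτ
  rw [Fintype.card_fin] at this
  refine le_trans (uniformProb_mono fun h hh => ?_) this
  rw [Set.mem_ofPred_eq] at hh ⊢
  exact hh.trans (Nat.cast_le.2 (linkLoad_le_card_linkPairs h t i j))

/-- The factor `n + 2` is slack, matching the form that `linkLoad_le_whp` expects. -/
theorem uniformProb_linkLoad_ge_of_broadcast (hρ : ∀ u v w, ρ u v = ρ u w) (t : ℕ) (i j : Fin k)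
    {τ : ℝ} :
    uniformProb {h : Fin n → Fin k |
      2 * ((Finset.univ.filter
        (fun u : Fin n => ∃ v, A.message know θ t u v ≠ [])).card : ℝ) / k + τ ≤
        A.linkLoad ρ know θ h t i j} ≤ (n + 2) * Real.exp (-τ) := by
  refine le_trans (uniformProb_mono fun h hh => ?_) ((uniformProb_classSize_ge (Finset.univ.filter
    (fun u : Fin n => ∃ v, A.message know θ t u v ≠ [])) i τ).trans ?_)
  · rw [Set.mem_ofPred_eq] at hh ⊢
    exact hh.trans (Nat.cast_le.2 (linkLoad_le_of_broadcast hρ h t i j))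
  · have := Real.exp_pos (-τ)
    nlinarith [(Nat.cast_nonneg n : (0 : ℝ) ≤ n)]

theorem simulate_time_of_degree [NeZero k] (henc : Function.Injective enc)
    (hs : ∀ S, (enc S).length = s * S.card) (hs1 : 1 ≤ s)
    (hW : 1 ≤ W) (hlen : MessageSizeAtMost A P b)
    (hρ : ∀ G ∈ P.domain, ∀ tape t u v, u ≠ v →
      A.message G.view tape t u (ρ u v) = A.message G.view tape t u v)
    (hn : 2 ≤ n) (hlog : 1 ≤ Real.log n) (hkn : k ≤ n) (hT : T ≤ n ^ 2) {M D : ℕ} (hD : 1 ≤ D)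
    (hM : MessageComplexityAtMost A P M) (hdeg : CommDegreeAtMost A P D) :
    KMachineAlgorithm.TimeAtMostWhp (A.simulate k b ρ enc T W) P
      (32 * s * (7 * Real.log n) ^ 2 *
        ((M : ℝ) / ((k : ℝ) ^ 2 * W) + (T : ℝ) * ⌈(D : ℝ) / ((k : ℝ) * W)⌉₊)) := by
  have hk : (0 : ℝ) < k := by exact_mod_cast Nat.pos_of_ne_zero (NeZero.ne k)
  have hW' : (1 : ℝ) ≤ W := by exact_mod_cast hW
  have hD' : (1 : ℝ) ≤ D := by exact_mod_cast hD
  have hs1' : (1 : ℝ) ≤ s := by exact_mod_cast hs1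
  set τ := 7 * Real.log n with hτdef
  have hτ : 1 ≤ τ := by linarith
  refine simulate_time henc hs hW hlen hρ fun G hG θ => ?_
  let m : ℕ → ℝ := fun r => ((Finset.univ.filter
    (fun p : Fin n × Fin n => A.message G.view θ r p.1 p.2 ≠ [])).card : ℝ)
  refine ⟨fun r => 8 * m r / (k : ℝ) ^ 2 + 6 * D * τ / k + τ ^ 2, fun r => by positivity, ?_,
    linkLoad_le_whp hn hkn hT fun r i j hij =>
      uniformProb_linkLoad_ge_of_degree hD (hdeg G hG θ r) hij (by linarith)⟩
  have hMsum : ∑ r ∈ Finset.range T, m r ≤ M := by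
    rw [← Nat.cast_sum]
    exact Nat.cast_le.2 (hM G hG θ T)
  set Z : ℝ := (⌈(D : ℝ) / ((k : ℝ) * W)⌉₊ : ℝ) with hZ
  have hZ1 : 1 ≤ Z := by
    rw [hZ, Nat.one_le_cast, Nat.one_le_ceil_iff]
    positivity
  have hDZ : (D : ℝ) / (k * W) ≤ Z := Nat.le_ceil _
  -- Both parts have constant 32: `4 * 8` for the message term, and `24 + 4 + 4` for the terms
  -- absorbed into `Z`, using `1 ≤ Z`.
  have hterm : ∀ r, 4 * (s * (8 * m r / (k : ℝ) ^ 2 + 6 * D * τ / k + τ ^ 2) / W + 1) ≤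
      32 * s * τ ^ 2 * (m r / ((k : ℝ) ^ 2 * W) + Z) := by
    intro r
    have e1 : 4 * (s * (8 * m r / (k : ℝ) ^ 2 + 6 * D * τ / k + τ ^ 2) / W + 1) =
        32 * (s * (m r / ((k : ℝ) ^ 2 * W))) + 24 * (s * τ * (D / (k * W))) +
          4 * (s * τ ^ 2 / W) + 4 := by
      field_simp
      ring
    have hm0 : 0 ≤ m r / ((k : ℝ) ^ 2 * W) := by positivity
    have hττ : τ ≤ τ ^ 2 := by nlinarith
    have hτ2 : 1 ≤ τ ^ 2 := by nlinarith
    have i1 : s * (m r / ((k : ℝ) ^ 2 * W)) ≤ s * τ ^ 2 * (m r / ((k : ℝ) ^ 2 * W)) := by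
      gcongr
      nlinarith
    have i2 : s * τ * (D / (k * W)) ≤ s * τ ^ 2 * Z := by gcongr
    have i3 : s * τ ^ 2 / W ≤ s * τ ^ 2 * Z := by
      refine (div_le_self (by positivity) hW').trans ?_
      exact le_mul_of_one_le_right (by positivity) hZ1
    have i4 : 1 ≤ s * τ ^ 2 * Z := by
      have : (1 : ℝ) ≤ s * τ ^ 2 := by nlinarith
      nlinarith
    rw [e1]
    linarith
  refine (Finset.sum_le_sum fun r _ => hterm r).trans ?_
  rw [← Finset.mul_sum, Finset.sum_add_distrib, ← Finset.sum_div, Finset.sum_const,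
    Finset.card_range, nsmul_eq_mul]
  gcongr

theorem simulate_time_of_broadcast [NeZero k] (henc : Function.Injective enc)
    (hs : ∀ S, (enc S).length = s * S.card) (hs1 : 1 ≤ s)
    (hW : 1 ≤ W) (hlen : MessageSizeAtMost A P b)
    (hρ : ∀ G ∈ P.domain, ∀ tape t u v, u ≠ v →
      A.message G.view tape t u (ρ u v) = A.message G.view tape t u v)
    (hρ' : ∀ u v w, ρ u v = ρ u w)
    (hn : 2 ≤ n) (hlog : 1 ≤ Real.log n) (hkn : k ≤ n) (hT : T ≤ n ^ 2) {B : ℕ}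
    (hB : BroadcastComplexityAtMost A P B) :
    KMachineAlgorithm.TimeAtMostWhp (A.simulate k b ρ enc T W) P
      (32 * s * (7 * Real.log n) ^ 2 * ((B : ℝ) / ((k : ℝ) * W) + T)) := by
  have hk : (0 : ℝ) < k := by exact_mod_cast Nat.pos_of_ne_zero (NeZero.ne k)
  have hW' : (1 : ℝ) ≤ W := by exact_mod_cast hW
  have hs1' : (1 : ℝ) ≤ s := by exact_mod_cast hs1
  set τ := 7 * Real.log n with hτdef
  have hτ : 1 ≤ τ := by linarith
  refine simulate_time henc hs hW hlen hρ fun G hG θ => ?_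
  let m : ℕ → ℝ := fun r => ((Finset.univ.filter
    (fun u : Fin n => ∃ v, A.message G.view θ r u v ≠ [])).card : ℝ)
  refine ⟨fun r => 2 * m r / k + τ, fun r => by positivity, ?_,
    linkLoad_le_whp hn hkn hT fun r i j _ => uniformProb_linkLoad_ge_of_broadcast hρ' r i j⟩
  have hBsum : ∑ r ∈ Finset.range T, m r ≤ B := by
    rw [← Nat.cast_sum]
    exact Nat.cast_le.2 (hB G hG θ T)
  have hterm : ∀ r, 4 * (s * (2 * m r / k + τ) / W + 1) ≤
      32 * s * τ ^ 2 * (m r / (k * W) + 1) := by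
    intro r
    have e1 : 4 * (s * (2 * m r / k + τ) / W + 1) =
        8 * (s * (m r / (k * W))) + 4 * (s * τ / W) + 4 := by
      field_simp
      ring
    have hm0 : 0 ≤ m r / (k * W) := by positivity
    have hτ2 : 1 ≤ τ ^ 2 := by nlinarith
    have i1 : s * (m r / (k * W)) ≤ s * τ ^ 2 * (m r / (k * W)) := by
      gcongr
      nlinarith
    have i2 : s * τ / W ≤ s * τ ^ 2 := by
      refine (div_le_self (by positivity) hW').trans ?_
      gcongr
      nlinarith
    have i3 : (1 : ℝ) ≤ s * τ ^ 2 := by nlinarith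
    have i4 : 0 ≤ s * τ ^ 2 * (m r / (k * W)) := by positivity
    rw [e1]
    linarith
  refine (Finset.sum_le_sum fun r _ => hterm r).trans ?_
  rw [← Finset.mul_sum, Finset.sum_add_distrib, ← Finset.sum_div, Finset.sum_const,
    Finset.card_range, nsmul_eq_mul, mul_one]
  gcongr

theorem simulate_time_zero [NeZero k] (henc : Function.Injective enc)
    (hs : ∀ S, (enc S).length = s * S.card) (hW : 1 ≤ W) (hlen : MessageSizeAtMost A P b)
    (hρ : ∀ G ∈ P.domain, ∀ tape t u v, u ≠ v →
      A.message G.view tape t u (ρ u v) = A.message G.view tape t u v)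
    {τ : ℝ} (hτ : 0 ≤ τ) :
    KMachineAlgorithm.TimeAtMostWhp (A.simulate k b ρ enc 0 W) P τ := by
  refine simulate_time henc hs hW hlen hρ fun G hG θ => ⟨0, fun _ => le_rfl, by simpa using hτ, ?_⟩
  have : {h : Fin n → Fin k | ∀ r < 0, ∀ i j, i ≠ j →
      (A.linkLoad ρ G.view θ h r i j : ℝ) ≤ (0 : ℕ → ℝ) r}ᶜ = ∅ := by simp
  rw [← compl_compl {h : Fin n → Fin k | _}, uniformProb_compl, this]
  simp [uniformProb]

end CliqueAlgorithm

/-! ### Absorbing constants and logarithms. -/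

theorem KMachineAlgorithm.TimeAtMostWhp.mono {n k : ℕ} {α β O : Type}
    {A : KMachineAlgorithm n k α β O} {P : GraphProblem n α β O} {τ τ' : ℝ}
    (h : KMachineAlgorithm.TimeAtMostWhp A P τ) (hτ : τ ≤ τ') :
    KMachineAlgorithm.TimeAtMostWhp A P τ' := fun G hG =>
  (h G hG).trans (uniformProb_mono fun _ ⟨t, ht, hh⟩ => ⟨t, ht.trans hτ, hh⟩)

theorem clog_two_le_three_mul_log {n : ℕ} (hn : 2 ≤ n) (hlog : 1 ≤ Real.log n) :
    (Nat.clog 2 n : ℝ) ≤ 3 * Real.log n := by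
  have h1 : 2 ^ (Nat.clog 2 n - 1) < n := Nat.pow_pred_clog_lt_self one_lt_two (by omega)
  have h2 : ((2 : ℝ) ^ (Nat.clog 2 n - 1)) ≤ n := by exact_mod_cast h1.le
  have h3 := Real.log_le_log (by positivity) h2
  rw [Real.log_pow, Nat.cast_sub (Nat.clog_pos one_lt_two hn)] at h3
  have h4 := Real.log_two_gt_d9
  push_cast at h3
  nlinarith

/-- Simulating with packets of length `O(log n + b n)` only costs a polylogarithmic factor. -/
theorem simulation_factor_le {n c b : ℕ} (hn : 2 ≤ n) (hlog : 1 ≤ Real.log n)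
    (hb : (b : ℝ) ≤ c * Real.log n ^ c) :
    32 * ((2 * Nat.clog 2 n + 2 * b : ℕ) : ℝ) * (7 * Real.log n) ^ 2 ≤
      ((1568 * (6 + 2 * c) : ℕ) : ℝ) * Real.log n ^ (1568 * (6 + 2 * c)) := by
  set l := Real.log n with hl
  have h1 : ((2 * Nat.clog 2 n + 2 * b : ℕ) : ℝ) ≤ (6 + 2 * c) * l ^ (c + 1) := by
    push_cast
    have h2 := clog_two_le_three_mul_log hn hlog
    have h3 : l ≤ l ^ (c + 1) := le_self_pow₀ hlog (by omega)
    have h4 : l ^ c ≤ l ^ (c + 1) := pow_le_pow_right₀ hlog (by omega)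
    have h5 : c * l ^ c ≤ c * l ^ (c + 1) := by gcongr
    rw [← hl] at h2
    linarith
  calc 32 * ((2 * Nat.clog 2 n + 2 * b : ℕ) : ℝ) * (7 * l) ^ 2
      ≤ 32 * ((6 + 2 * c) * l ^ (c + 1)) * (7 * l) ^ 2 := by gcongr
    -- `1568 = 32 * 7 ^ 2`; one number then serves as both factor and exponent.
    _ = ((1568 * (6 + 2 * c) : ℕ) : ℝ) * l ^ (c + 3) := by push_cast; ring
    _ ≤ _ := by
        gcongr
        omega

theorem IsSoftO.eventually_le_sq {T : ℕ → ℕ}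
    (hT : IsSoftO (fun n => (T n : ℝ)) (fun n => (n : ℝ))) :
    ∃ n₀, ∀ n ≥ n₀, T n ≤ n ^ 2 := by
  obtain ⟨c, n₁, h⟩ := hT
  have h1 : (fun x : ℝ => (c : ℝ) * Real.log x ^ c) =o[Filter.atTop] (id : ℝ → ℝ) :=
    (Real.isLittleO_pow_log_id_atTop (n := c)).const_mul_left _
  have h2 := (h1.comp_tendsto tendsto_natCast_atTop_atTop).bound (one_pos : (0 : ℝ) < 1)
  obtain ⟨n₂, h3⟩ := Filter.eventually_atTop.1 h2
  refine ⟨max n₁ n₂, fun n hn => ?_⟩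
  have h4 := h n (le_trans (le_max_left _ _) hn)
  have h5 := h3 n (le_trans (le_max_right _ _) hn)
  simp only [Function.comp_apply, id, one_mul, Real.norm_natCast] at h5
  have h6 : (c : ℝ) * Real.log n ^ c * n ≤ n * n := by
    gcongr
    exact (Real.le_norm_self _).trans h5
  have h7 : (T n : ℝ) ≤ (n : ℝ) ^ 2 := by
    rw [sq]
    exact h4.trans h6
  exact_mod_cast h7

end

theorem mainTheorem5 (T_C b : ℕ → ℕ)
    (hT : IsSoftO (fun n => (T_C n : ℝ)) (fun n => (n : ℝ)))
    (hb : IsSoftO (fun n => (b n : ℝ)) (fun _ => 1)) :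
    ∃ c n₀ : ℕ, ∀ n ≥ n₀, ∀ k W : ℕ, 1 < k → k ≤ n → 1 ≤ W →
      ∀ (α β O : Type) (P : GraphProblem n α β O) (ε : ℝ) (A_C : CliqueAlgorithm n α β O),
        CliqueAlgorithm.HasError A_C P ε →
        CliqueAlgorithm.TimeAtMost A_C P (T_C n) →
        CliqueAlgorithm.MessageSizeAtMost A_C P (b n) →
        ∃ A : KMachineAlgorithm n k α β O,
          KMachineAlgorithm.RespectsBandwidth A P W ∧
          KMachineAlgorithm.HasError A P ε ∧
          (∀ M Δ' : ℕ,
            CliqueAlgorithm.MessageComplexityAtMost A_C P M →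
            CliqueAlgorithm.CommDegreeAtMost A_C P Δ' →
            KMachineAlgorithm.TimeAtMostWhp A P
              (c * Real.log n ^ c *
                ((M : ℝ) / ((k : ℝ) ^ 2 * W) +
                  (T_C n : ℝ) * ⌈(Δ' : ℝ) / ((k : ℝ) * W)⌉₊))) ∧
          (∀ B : ℕ,
            CliqueAlgorithm.IsBroadcast A_C P →
            CliqueAlgorithm.BroadcastComplexityAtMost A_C P B →
            KMachineAlgorithm.TimeAtMostWhp A P
              (c * Real.log n ^ c * ((B : ℝ) / ((k : ℝ) * W) + T_C n))) := by
  obtain ⟨n₁, hT⟩ := hT.eventually_le_sq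
  obtain ⟨c, n₂, hb⟩ := hb
  refine ⟨1568 * (6 + 2 * c), max 3 (max n₁ n₂), ?_⟩
  intro n hn k W hk hkn hW α β O P ε A_C herr htime hsize
  simp only [ge_iff_le, max_le_iff] at hn
  obtain ⟨hn3, hn1, hn2⟩ := hn
  have hn2' : 2 ≤ n := by omega
  have hlog : 1 ≤ Real.log n := by
    rw [Real.le_log_iff_exp_le (by positivity)]
    have : (3 : ℝ) ≤ n := by exact_mod_cast hn3
    linarith [Real.exp_one_lt_d9]
  have hfac := simulation_factor_le hn2' hlog (by simpa using hb n hn2)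
  have hTn := hT n hn1
  have : NeZero k := ⟨by omega⟩
  obtain ⟨enc, henc, hs⟩ := exists_packet_code n (b n) hn2'
  have hs1 : 1 ≤ 2 * Nat.clog 2 n + 2 * b n := by
    have := Nat.clog_pos one_lt_two hn2'
    omega
  -- `A` must be chosen before `M` and `Δ'`, so the split is on whether `A_C` ever sends a message.
  -- If it does, then `Δ' ≥ 1` and the ceiling in (a) is at least 1.
  by_cases hsilent : ∀ G ∈ P.domain, ∀ tape t u v, A_C.message G.view tape t u v = []
  · have hconf : ∀ G ∈ P.domain, ∀ tape v, (A_C.skipRounds (T_C n)).outputAt G.view tape 0 v =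
        A_C.outputAt G.view tape (T_C n) v := fun G hG tape v =>
      congrArg (fun σ : Fin n → A_C.State => A_C.output v (σ v))
        (A_C.skipRounds_config_zero (T := T_C n) (hsilent G hG tape))
    have hnil : ∀ G ∈ P.domain, ∀ tape t u v,
        (A_C.skipRounds (T_C n)).message G.view tape t u v = [] := fun G hG tape t u v =>
      SyncAlgorithm.message_eq_nil_of_haltsBy _ (Nat.zero_le t)
        (fun u => by rw [hconf G hG]; exact htime G hG tape u) u v
    have hlen : CliqueAlgorithm.MessageSizeAtMost (A_C.skipRounds (T_C n)) P (b n) :=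
      fun G hG tape t u v => by rw [hnil G hG]; simp
    refine ⟨CliqueAlgorithm.simulate (A_C.skipRounds (T_C n)) k (b n) (fun _ v => v) enc 0 W,
      fun G _ h tape t i j => SyncAlgorithm.throttle_bandwidth _ _ _ _ _ hW t i j,
      CliqueAlgorithm.simulate_hasError henc hs hW hlen (fun _ _ _ _ _ _ _ => rfl) ?_,
      fun M D _ _ => CliqueAlgorithm.simulate_time_zero henc hs hW hlen
        (fun _ _ _ _ _ _ _ => rfl) (by positivity),
      fun B _ _ => CliqueAlgorithm.simulate_time_zero henc hs hW hlen
        (fun _ _ _ _ _ _ _ => rfl) (by positivity)⟩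
    intro G hG
    refine (herr.hasErrorAt htime G hG).trans (uniformProb_mono ?_)
    rintro θ ⟨o, ho, hout⟩
    exact ⟨o, ho, fun v => (hconf G hG θ v).trans (hout v)⟩
  have hD : ∀ D, CliqueAlgorithm.CommDegreeAtMost A_C P D → 1 ≤ D := by
    intro D hdeg
    push Not at hsilent
    obtain ⟨G, hG, tape, t, u, v, hne⟩ := hsilent
    exact (Finset.card_pos.2 ⟨v, by simpa using hne⟩).trans_le (hdeg G hG tape t u).1
  have : Nontrivial (Fin n) := Fin.nontrivial_iff_two_le.2 hn2'
  -- One `ρ` has to serve both (a) and (b). For a broadcast algorithm it addresses all packets of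
  -- `u` to one vertex other than `u`; merging packets never increases the load, so (a) is
  -- unaffected.
  obtain ⟨ρ, hρ, hbc⟩ : ∃ ρ : Fin n → Fin n → Fin n,
      (∀ G ∈ P.domain, ∀ tape t u v, u ≠ v →
        A_C.message G.view tape t u (ρ u v) = A_C.message G.view tape t u v) ∧
      (CliqueAlgorithm.IsBroadcast A_C P → ∀ u v w, ρ u v = ρ u w) := by
    by_cases hB : CliqueAlgorithm.IsBroadcast A_C P
    · refine ⟨fun u _ => (exists_ne u).choose, fun G hG tape t u v huv => ?_, fun _ _ _ _ => rfl⟩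
      exact hB G hG tape t u _ _ (exists_ne u).choose_spec huv.symm
    · exact ⟨fun _ v => v, fun _ _ _ _ _ _ _ => rfl, fun h => absurd h hB⟩
  refine ⟨CliqueAlgorithm.simulate A_C k (b n) ρ enc (T_C n) W,
    fun G _ h tape t i j => SyncAlgorithm.throttle_bandwidth _ _ _ _ _ hW t i j,
    CliqueAlgorithm.simulate_hasError henc hs hW hsize hρ (herr.hasErrorAt htime),
    fun M D hM hdeg => ?_, fun B hB hBc => ?_⟩
  · refine (CliqueAlgorithm.simulate_time_of_degree henc hs hs1 hW hsize hρ hn2' hlog hkn hTn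
      (hD D hdeg) hM hdeg).mono ?_
    gcongr
  · refine (CliqueAlgorithm.simulate_time_of_broadcast henc hs hs1 hW hsize hρ (hbc hB) hn2' hlog
      hkn hTn hBc).mono ?_
    gcongr
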